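/- Let $G=(V,E)$ be an infinite, connected, locally finite graph that is vertex-transitive (for any $u,v\in V$ some automorphism of $G$ maps $u$ to $v$) and amenable (for every $\varepsilon>0$ there is a finite non-empty $F\subset V$ with $|\partial F|\le\varepsilon|F|$, where $\partial F$ is the set of vertices outside $F$ having a neighbour in $F$). Consider activated random walks (ARW) on $G$ with sleeping rate $\lambda>0$ and particle density $\mu\in[0,1]$. Initially each vertex holds, independently, one active particle with probability $\mu$ and no particle otherwise. Each active particle performs an independent continuous-time random walk on $G$ with jump rate $1$, each jump being to a uniformly random neighbour; in addition it has an independent Poisson clock of rate $\lambda$, and when this clock rings the particle falls asleep if it shares its vertex with no other particle, and nothing happens otherwise. A sleeping particle does not move, and becomes active as soon as another particle jumps to its vertex. On the infinite graph, the process is the limit of the processes that keep only the particles initially in a finite set $\Lambda\subset V$, as $\Lambda$ increases to $V$. We say that ARW fixates if for every vertex $x$ there is a time after which $x$ never contains an active particle, and that ARW is active otherwise. Let $$\mu_c=\mu_c(\lambda):=\inf\{\mu\in[0,1] : P(\text{ARW is active})>0\},$$ where the infimum is taken in $[0,1]$ (so that $\inf\emptyset=1$). Then, for every $\lambda>0$,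 $$\mu_c>0,\qquad\text{and more specifically}\qquad \mu_c\ \ge\ \frac{\lambda}{1+\lambda}.$$ -/

import Mathlib

open MeasureTheory ProbabilityTheory Filter
open scoped NNReal ENNReal unitInterval

noncomputable section

namespace ARW

/-! ### Graph notions -/

/-- Any vertex can be mapped onto any other one by a graph automorphism. -/
def VertexTransitive {V : Type*} (G : SimpleGraph V) : Prop :=
  ∀ u v : V, ∃ φ : G ≃g G, φ u = v

/-- The external vertex boundary of a set of vertices. -/
def extBoundary {V : Type*} (G : SimpleGraph V) (F : Set V) : Set V :=
  {v | v ∉ F ∧ ∃ u ∈ F, G.Adj u v}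

/-- Amenability: there are finite non-empty vertex sets whose external boundary is arbitrarily
small compared with the set (all boundaries are finite when the graph is locally finite). -/
def Amenable {V : Type*} (G : SimpleGraph V) : Prop :=
  ∀ ε : ℝ, 0 < ε → ∃ F : Finset V, F.Nonempty ∧
    ((extBoundary G (F : Set V)).ncard : ℝ) ≤ ε * (F.card : ℝ)

/-! ### Configurations and instructions -/

/-- The state of a vertex: one sleeping particle, or `n` active particles (`n = 0`: no particle). -/
inductive SiteState : Type
  | sleeping : SiteState
  | active : ℕ → SiteState

namespace SiteState

/-- The number of active particles. -/
def numActive : SiteState → ℕ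
  | sleeping => 0
  | active n => n

/-- A particle jumps in; it wakes up the sleeping particle, if there is one. -/
def addParticle : SiteState → SiteState
  | sleeping => active 2
  | active n => active (n + 1)

/-- An active particle, if there is one, leaves. -/
def removeParticle : SiteState → SiteState
  | sleeping => sleeping
  | active n => active (n - 1)

/-- An active particle tries to fall asleep: this succeeds only if it is alone. -/
def trySleep : SiteState → SiteState
  | active 1 => sleeping
  | s => s

end SiteState

/-- What a particle does when its clock rings: try to fall asleep, or jump to a given vertex. -/
inductive Instruction (V : Type*) : Type _
  | sleep : Instruction V
  | jump : V → Instruction V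

instance {V : Type*} : MeasurableSpace (Instruction V) := ⊤

open Classical in
/-- The effect on a configuration of a particle at `x` following an instruction. -/
def applyInstruction {V : Type*} (x : V) :
    Instruction V → (V → SiteState) → (V → SiteState)
  | .sleep, η => Function.update η x (η x).trySleep
  | .jump y, η =>
      let η' := Function.update η x (η x).removeParticle
      Function.update η' y (η' y).addParticle

/-! ### Randomness -/

/-- The random input: which vertices initially hold a particle; the instruction used at the
`j`-th ring of the clock of each vertex; the waiting times between successive rings of these
clocks. -/
abbrev Sample (V : Type*) : Type _ :=
  (V → Bool) × (V × ℕ → Instruction V) × (V × ℕ → ℝ)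

/-- The law of an instruction at `x`: sleep with probability `λ / (1 + λ)`, and jump to each of
the `d` neighbours with probability `1 / (d (1 + λ))`. -/
def instructionLaw {V : Type*} (G : SimpleGraph V) [G.LocallyFinite] (lam : ℝ≥0) (x : V) :
    Measure (Instruction V) :=
  (lam / (1 + lam)) • Measure.dirac Instruction.sleep +
    ∑ y ∈ G.neighborFinset x,
      (1 / ((G.degree x : ℝ≥0) * (1 + lam))) • Measure.dirac (Instruction.jump y)

/-- The law of the random input: independent Bernoulli(`μ`) particles, independent instructions,
independent waiting times that are exponential of parameter `1`. -/
def sampleLaw {V : Type*} (G : SimpleGraph V) [G.LocallyFinite] (lam : ℝ≥0) (μ : I) :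
    Measure (Sample V) :=
  (Measure.infinitePi fun _ : V => bernoulliMeasure true false μ).prod
    ((Measure.infinitePi fun p : V × ℕ => instructionLaw G lam p.1).prod
      (Measure.infinitePi fun _ : V × ℕ => expMeasure 1))

lemma isProbabilityMeasure_instructionLaw {V : Type*} (G : SimpleGraph V) [G.LocallyFinite]
    (lam : ℝ≥0) (x : V) (hx : 0 < G.degree x) :
    IsProbabilityMeasure (instructionLaw G lam x) := by
  constructor
  have h1 : (1 + lam : ℝ≥0) ≠ 0 := by positivity
  have h2 : (G.degree x : ℝ≥0) ≠ 0 := by exact_mod_cast hx.ne'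
  have h3 : lam / (1 + lam) +
      (G.degree x : ℝ≥0) * (1 / ((G.degree x : ℝ≥0) * (1 + lam))) = 1 := by
    field_simp
    ring
  simp only [instructionLaw, Measure.add_apply, Measure.smul_apply, measure_univ,
    Measure.finsetSum_apply, Finset.sum_const, SimpleGraph.card_neighborFinset_eq_degree,
    ENNReal.smul_def, smul_eq_mul, mul_one, nsmul_eq_mul]
  exact_mod_cast h3

lemma isProbabilityMeasure_sampleLaw {V : Type*} (G : SimpleGraph V) [G.LocallyFinite]
    (lam : ℝ≥0) (μ : I) (hG : ∀ x, 0 < G.degree x) :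
    IsProbabilityMeasure (sampleLaw G lam μ) := by
  have h1 : ∀ p : V × ℕ, IsProbabilityMeasure (instructionLaw G lam p.1) :=
    fun p => isProbabilityMeasure_instructionLaw G lam p.1 (hG p.1)
  have h2 : IsProbabilityMeasure (expMeasure 1) := isProbabilityMeasure_expMeasure one_pos
  unfold sampleLaw
  infer_instance

/-! ### The process started from finitely many particles

A vertex holding `k` active particles has `k` independent jump clocks of rate `1` and `k`
independent sleep clocks of rate `λ`. They are realised as one clock at the vertex, which rings
at total rate `(1 + λ) k`: its rings are those of a rate-`1` Poisson process that is run at speed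
`(1 + λ) k`. Each ring is, independently, a sleep ring with probability `λ / (1 + λ)` and
otherwise a jump to a uniform neighbour. -/

/-- The state of the process: the present time, the configuration, the number of past rings at
each vertex, and the internal time of the clock of each vertex. -/
structure State (V : Type*) where
  time : ℝ
  config : V → SiteState
  rings : V → ℕ
  clock : V → ℝ

/-- The speed of the clock of `x`: the total rate `(1 + λ) k` of its `k` active particles. -/
def State.speed {V : Type*} (lam : ℝ≥0) (s : State V) (x : V) : ℝ :=
  (1 + lam) * ((s.config x).numActive : ℝ)

/-- The internal time at which the clock of `x` rings for the `(j + 1)`-st time. -/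
def ringTime {V : Type*} (ω : Sample V) (x : V) (j : ℕ) : ℝ :=
  ∑ i ∈ Finset.range (j + 1), ω.2.2 (x, i)

/-- The real time until the next ring at `x`, if the configuration does not change before
(meaningful if `x` has an active particle). -/
def State.wait {V : Type*} (lam : ℝ≥0) (ω : Sample V) (s : State V) (x : V) : ℝ :=
  (ringTime ω x (s.rings x) - s.clock x) / s.speed lam x

/-- `x` is the vertex whose clock rings next. -/
def State.IsNext {V : Type*} (lam : ℝ≥0) (ω : Sample V) (s : State V) (x : V) : Prop :=
  0 < (s.config x).numActive ∧
    ∀ y, 0 < (s.config y).numActive → s.wait lam ω x ≤ s.wait lam ω y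

/-- The state just after the next ring, when this ring is at `x`: the clocks have advanced, and the
next unused instruction at `x` is followed. -/
def State.ring {V : Type*} (lam : ℝ≥0) (ω : Sample V) (s : State V) (x : V) : State V :=
  open Classical in
  { time := s.time + s.wait lam ω x
    config := applyInstruction x (ω.2.1 (x, s.rings x)) s.config
    rings := Function.update s.rings x (s.rings x + 1)
    clock := fun y => s.clock y + s.wait lam ω x * s.speed lam y }

open Classical in
/-- The state just after the next ring. If there is no active particle, then one unit of time
passes and nothing happens. -/
def State.next {V : Type*} (lam : ℝ≥0) (ω : Sample V) (s : State V) : State V :=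
  if h : ∃ x, s.IsNext lam ω x then s.ring lam ω h.choose else { s with time := s.time + 1 }

open Classical in
/-- The initial state, with the particles outside the finite set `Λ` removed. -/
def initialState {V : Type*} (ω : Sample V) (Λ : Finset V) : State V where
  time := 0
  config := fun x => .active (if x ∈ Λ ∧ ω.1 x = true then 1 else 0)
  rings := fun _ => 0
  clock := fun _ => 0

/-- The state after `n` events, when only the particles initially in `Λ` are kept. -/
def stateAfter {V : Type*} (lam : ℝ≥0) (ω : Sample V) (Λ : Finset V) (n : ℕ) : State V :=
  (State.next lam ω)^[n] (initialState ω Λ)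

/-- The configuration at time `t`, when only the particles initially in `Λ` are kept: the one
after the last event that occurs up to time `t`. -/
def finiteConfig {V : Type*} (lam : ℝ≥0) (ω : Sample V) (Λ : Finset V) (t : ℝ) :
    V → SiteState :=
  (stateAfter lam ω Λ (sSup {n : ℕ | (stateAfter lam ω Λ n).time ≤ t})).config

/-! ### The process with infinitely many particles, activity and the critical density -/

open Classical in
/-- The state of `x` at time `t`: the eventual value, as `Λ` increases to the whole vertex set,
of the state of `x` at time `t` for the process that keeps only the particles initially in `Λ`.
(The default value matters on a null event only.) -/
def siteState {V : Type*} (lam : ℝ≥0) (ω : Sample V) (t : ℝ) (x : V) : SiteState :=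
  if h : ∃ s : SiteState, ∀ᶠ Λ : Finset V in atTop, finiteConfig lam ω Λ t x = s then
    h.choose
  else
    .active 0

/-- Fixation: each vertex is eventually without active particles, forever. -/
def Fixates {V : Type*} (lam : ℝ≥0) (ω : Sample V) : Prop :=
  ∀ x : V, ∃ T : ℝ, ∀ t : ℝ, T ≤ t → (siteState lam ω t x).numActive = 0

/-- The probability that the process of sleeping rate `lam` and particle density `μ` is active,
that is, does not fixate. -/
def probActive {V : Type*} (G : SimpleGraph V) [G.LocallyFinite] (lam : ℝ≥0) (μ : I) : ℝ≥0∞ :=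
  sampleLaw G lam μ {ω | ¬ Fixates lam ω}

/-- The critical density: the infimum, in `[0, 1]`, of the densities at which the process is
active with positive probability (it is `1` if there are none). -/
def criticalDensity {V : Type*} (G : SimpleGraph V) [G.LocallyFinite] (lam : ℝ≥0) : I :=
  sInf {μ : I | 0 < probActive G lam μ}

end ARW

end

/-! Write q = λ/(1+λ) for the probability that an instruction is a sleep instruction. The process is
reduced to stacks of instructions: each vertex reads its own stack, and a toppling is legal when the
vertex holds an active particle. Legal topplings of distinct vertices commute (`topple_comm`), so
two legal sequences that stabilise a finite set use the same instructions and end in the same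
configuration (`IsLegal.run_eq_of_isStable`).

Fix a finite set K and x in K. If an active particle can be brought to x, stabilise K without ever
moving the last active particle at x. The next instruction at x is still unread, so it is sleep with
probability q, independently of the past. When it is, following it stabilises all of K, with a
sleeping particle at x. By uniqueness all such x carry a particle in one and the same configuration,
so they are at most as numerous as the initial particles in K (`card_sleepers_le`). In expectation,
q times the number of visited vertices is at most the number of particles.

Let a be the probability that every vertex is visited from some finite set. No ergodicity is needed:
the expectation is taken on an event B approximating this one and depending on a finite set K₁ only,
hence independent of particles and instructions elsewhere (`sum_visited_mul_le`). By transitivity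
and amenability, K can be chosen so that most of its vertices lie so deep that being visited within
K is almost the same as being visited at all. Letting the errors vanish in `density_estimate` gives
a q ≤ a μ, so a = 0 when μ < q.

Finally, almost surely, absence of fixation forces every vertex to be visited. If the topplings of
each vertex are bounded uniformly over finite initial sets, the process fixates
(`fixates_of_not_unbounded`); and unboundedness at one vertex spreads to all others
(`Unbounded.all`). The link with continuous time requires that the event times diverge, which
follows by weighing the at most |Λ|^n legal sequences of length n against the Laplace transform of
the waiting times. -/

noncomputable section

namespace ARW

set_option autoImplicit false

open scoped Classical

/-! ### The local effect of an instruction -/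

namespace SiteState

/-- The number of particles, active or sleeping. -/
def count : SiteState → ℕ
  | sleeping => 1
  | active n => n

/-- `s ≤ s'` in the order `0 < sleeping < 1 < 2 < ⋯`. -/
def Below (s s' : SiteState) : Prop :=
  s.numActive ≤ s'.numActive ∧ s.count ≤ s'.count

lemma numActive_le_count (s : SiteState) : s.numActive ≤ s.count := by
  cases s <;> simp [numActive, count]

end SiteState

/-- The effect at `z` of the instruction `i` used at `x`. -/
def localEffect {V : Type*} (x : V) (i : Instruction V) (z : V) (s : SiteState) : SiteState :=
  match i with
  | .sleep => if z = x then s.trySleep else s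
  | .jump y =>
    if z = y then (if z = x then s.removeParticle else s).addParticle
    else (if z = x then s.removeParticle else s)

section Discrete

variable {V : Type*}

lemma applyInstruction_apply (x : V) (i : Instruction V) (η : V → SiteState) (z : V) :
    applyInstruction x i η z = localEffect x i z (η z) := by
  cases i with
  | sleep =>
    by_cases h : z = x
    · subst h; simp [applyInstruction, localEffect]
    · simp [applyInstruction, localEffect, h]
  | jump y =>
    by_cases hy : z = y
    · subst hy
      by_cases hx : z = x
      · subst hx; simp [applyInstruction, localEffect]
      · simp [applyInstruction, localEffect, hx]
    · by_cases hx : z = x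
      · subst hx; simp [applyInstruction, localEffect, hy]
      · simp [applyInstruction, localEffect, hx, hy]

/-- The delicate case is a sleep instruction at `x` against a jump into `x`: starting from one
active particle, both orders give two active ones. Activity is needed: from an empty vertex, sleep
then arrival leaves an active particle, arrival then sleep a sleeping one. -/
lemma localEffect_comm {x y : V} (hxy : x ≠ y) (i j : Instruction V) (z : V) (s : SiteState)
    (hx : z = x → 0 < s.numActive) (hy : z = y → 0 < s.numActive) :
    localEffect x i z (localEffect y j z s) = localEffect y j z (localEffect x i z s) := by
  rcases s with _ | _ | _ | n <;> rcases i with _ | a <;> rcases j with _ | b <;>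
    simp only [localEffect] <;> split_ifs <;>
    simp_all [SiteState.trySleep, SiteState.addParticle, SiteState.removeParticle,
      SiteState.numActive]

lemma numActive_le_localEffect {x z : V} (h : z ≠ x) (i : Instruction V) (s : SiteState) :
    s.numActive ≤ (localEffect x i z s).numActive := by
  rcases s with _ | n <;> rcases i with _ | a <;> simp only [localEffect] <;> split_ifs <;>
    simp_all [SiteState.addParticle, SiteState.numActive]

lemma one_le_numActive_localEffect {x z : V} (i : Instruction V) (s : SiteState)
    (h : 1 < s.numActive) : 0 < (localEffect x i z s).numActive := by
  rcases s with _ | _ | _ | n <;> rcases i with _ | a <;> simp only [localEffect] <;> split_ifs <;>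
    simp_all [SiteState.addParticle, SiteState.numActive, SiteState.removeParticle,
      SiteState.trySleep]

/-- Conservation of particles, with departures and arrivals on opposite sides so that no truncated
subtraction occurs. Activity ensures that a departure really removes a particle. -/
lemma count_localEffect (x z : V) (i : Instruction V) (s : SiteState)
    (h : z = x → 0 < s.numActive) :
    (localEffect x i z s).count + (if z = x ∧ i ≠ .sleep then 1 else 0) =
      s.count + (if i = .jump z then 1 else 0) := by
  rcases s with _ | _ | _ | n <;> rcases i with _ | a <;> simp only [localEffect] <;>
    split_ifs <;>
    simp_all [SiteState.addParticle, SiteState.numActive, SiteState.removeParticle,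
      SiteState.trySleep, SiteState.count]

/-- Activity in the smaller state excludes a departure that would have no effect there but would
remove a particle from the larger state. -/
lemma Below.localEffect {x z : V} (i : Instruction V) {s s' : SiteState} (hs : s.Below s')
    (h : z = x → 0 < s.numActive) :
    (localEffect x i z s).Below (localEffect x i z s') := by
  obtain ⟨h1, h2⟩ := hs
  rcases s with _ | _ | _ | n <;> rcases s' with _ | _ | _ | m <;> rcases i with _ | a <;>
    simp only [ARW.localEffect] <;> split_ifs <;>
    simp_all [SiteState.addParticle, SiteState.numActive, SiteState.removeParticle,
      SiteState.trySleep, SiteState.count, SiteState.Below]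

/-! ### Legal topplings and the abelian property -/

/-- A configuration together with the number of instructions used at each vertex. -/
abbrev Stage (V : Type*) : Type _ := (V → SiteState) × (V → ℕ)

/-- The next unused instruction at `x` is followed. -/
def topple (τ : V × ℕ → Instruction V) (x : V) (s : Stage V) : Stage V :=
  (applyInstruction x (τ (x, s.2 x)) s.1, Function.update s.2 x (s.2 x + 1))

/-- The vertices are toppled in the order of the list. -/
def run (τ : V × ℕ → Instruction V) : Stage V → List V → Stage V
  | s, [] => s
  | s, v :: l => run τ (topple τ v s) l

/-- A rule telling which vertices may be toppled, in terms of their number of active particles. -/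
structure ToppleRule (V : Type*) where
  allows : V → ℕ → Prop
  mono : ∀ v m n, m ≤ n → allows v m → allows v n
  pos : ∀ v n, allows v n → 0 < n

/-- The vertices of `K` may be toppled when they have an active particle. -/
def ToppleRule.on (K : Set V) : ToppleRule V where
  allows v n := v ∈ K ∧ 0 < n
  mono _ _ _ h h' := ⟨h'.1, h'.2.trans_le h⟩
  pos _ _ h := h.2

/-- The vertices of `K` may be toppled when they have an active particle, but the last active
particle at `x` may not be moved. -/
def ToppleRule.keepOne (K : Set V) (x : V) : ToppleRule V where
  allows v n := v ∈ K ∧ 0 < n ∧ (v = x → 1 < n)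
  mono _ _ _ h h' := ⟨h'.1, h'.2.1.trans_le h, fun e => (h'.2.2 e).trans_le h⟩
  pos _ _ h := h.2.1

/-- Each toppling in the list is allowed when it is made. -/
def IsLegal (R : ToppleRule V) (τ : V × ℕ → Instruction V) : Stage V → List V → Prop
  | _, [] => True
  | s, v :: l => R.allows v (s.1 v).numActive ∧ IsLegal R τ (topple τ v s) l

/-- No toppling is allowed. -/
def IsStable (R : ToppleRule V) (s : Stage V) : Prop :=
  ∀ v, ¬ R.allows v (s.1 v).numActive

variable {R R' : ToppleRule V} {τ : V × ℕ → Instruction V}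

lemma topple_fst_apply (x : V) (s : Stage V) (z : V) :
    (topple τ x s).1 z = localEffect x (τ (x, s.2 x)) z (s.1 z) :=
  applyInstruction_apply _ _ _ _

lemma topple_snd_apply (x : V) (s : Stage V) (z : V) :
    (topple τ x s).2 z = s.2 z + if z = x then 1 else 0 := by
  by_cases h : z = x
  · subst h; simp [topple]
  · simp [topple, h]

lemma topple_comm {x y : V} (hxy : x ≠ y) {s : Stage V} (hx : 0 < (s.1 x).numActive)
    (hy : 0 < (s.1 y).numActive) :
    topple τ x (topple τ y s) = topple τ y (topple τ x s) := by
  refine Prod.ext (funext fun z => ?_) (funext fun z => ?_)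
  · simp only [topple_fst_apply, topple_snd_apply, if_neg hxy, if_neg hxy.symm, add_zero]
    exact localEffect_comm hxy _ _ _ _ (fun h => h ▸ hx) (fun h => h ▸ hy)
  · simp only [topple_snd_apply]
    ring

lemma allows_topple {x y : V} (hxy : y ≠ x) {s : Stage V}
    (h : R.allows y (s.1 y).numActive) : R.allows y ((topple τ x s).1 y).numActive := by
  refine R.mono _ _ _ ?_ h
  rw [topple_fst_apply]
  exact numActive_le_localEffect hxy _ _

lemma run_append (s : Stage V) (l l' : List V) : run τ s (l ++ l') = run τ (run τ s l) l' := by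
  induction l generalizing s with
  | nil => rfl
  | cons v l ih => exact ih _

lemma isLegal_append {s : Stage V} {l l' : List V} :
    IsLegal R τ s (l ++ l') ↔ IsLegal R τ s l ∧ IsLegal R τ (run τ s l) l' := by
  induction l generalizing s with
  | nil => simp [IsLegal, run]
  | cons v l ih => simp [IsLegal, run, ih, and_assoc]

lemma IsLegal.imp {s : Stage V} {l : List V} (h : IsLegal R τ s l)
    (hR : ∀ v n, R.allows v n → R'.allows v n) : IsLegal R' τ s l := by
  induction l generalizing s with
  | nil => trivial
  | cons v l ih => exact ⟨hR _ _ h.1, ih h.2⟩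

lemma run_snd_apply (s : Stage V) (l : List V) (z : V) :
    (run τ s l).2 z = s.2 z + l.count z := by
  induction l generalizing s with
  | nil => simp [run]
  | cons v l ih =>
    rw [run, ih, topple_snd_apply, List.count_cons, add_assoc, add_comm (ite _ _ _)]
    by_cases h : z = v
    · simp [h]
    · simp [h, Ne.symm h]

/-- Topplings elsewhere never decrease the active particles at `x`, so `x` stays allowed until it is
toppled; a stabilising sequence must therefore topple it. Its first toppling commutes with all the
earlier ones. -/
lemma IsLegal.move_to_front {x : V} {l : List V} {s : Stage V} (hl : IsLegal R τ s l)
    (hst : IsStable R (run τ s l)) (hx : R.allows x (s.1 x).numActive) :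
    x ∈ l ∧ IsLegal R τ s (x :: l.erase x) ∧ run τ s (x :: l.erase x) = run τ s l := by
  induction l generalizing s with
  | nil => exact absurd hx (hst x)
  | cons y l ih =>
    by_cases hxy : y = x
    · subst hxy
      simp only [List.mem_cons, true_or, List.erase_cons_head, true_and]
      exact ⟨hl, trivial⟩
    · obtain ⟨h1, h2, h3⟩ := ih hl.2 hst (allows_topple (Ne.symm hxy) hx)
      have hc : topple τ y (topple τ x s) = topple τ x (topple τ y s) :=
        topple_comm hxy (R.pos _ _ hl.1) (R.pos _ _ hx)
      have he : (y :: l).erase x = y :: l.erase x := by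
        rw [List.erase_cons_tail]; simpa using hxy
      refine ⟨List.mem_cons_of_mem _ h1, ?_, ?_⟩
      · rw [he]
        refine ⟨hx, allows_topple hxy hl.1, ?_⟩
        rw [hc]; exact h2.2
      · rw [he, run, run, hc]
        exact h3

/-- Any legal sequence can be completed to a rearrangement of a given stabilising one. -/
lemma IsLegal.exists_completion {l b : List V} {s : Stage V} (hl : IsLegal R τ s l)
    (hb : IsLegal R τ s b) (hst : IsStable R (run τ s b)) :
    ∃ c, IsLegal R τ (run τ s l) c ∧ run τ s (l ++ c) = run τ s b ∧ (l ++ c).Perm b := by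
  induction l generalizing s b with
  | nil => exact ⟨b, hb, rfl, List.Perm.refl _⟩
  | cons x l ih =>
    obtain ⟨h1, h2, h3⟩ := hb.move_to_front hst hl.1
    obtain ⟨c, hc1, hc2, hc3⟩ := ih hl.2 h2.2 (by rw [← h3] at hst; exact hst)
    refine ⟨c, hc1, ?_, ?_⟩
    · rw [List.cons_append, run, hc2, ← h3, run]
    · exact (hc3.cons x).trans (List.perm_cons_erase h1).symm

/-- The abelian property: the completion of `l` to a rearrangement of `b` must be empty, since
nothing is allowed after `l`. -/
lemma IsLegal.run_eq_of_isStable {l b : List V} {s : Stage V} (hl : IsLegal R τ s l)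
    (hb : IsLegal R τ s b) (hlst : IsStable R (run τ s l)) (hst : IsStable R (run τ s b)) :
    run τ s l = run τ s b := by
  obtain ⟨c, hc1, hc2, -⟩ := hl.exists_completion hb hst
  cases c with
  | nil => simpa using hc2
  | cons v c => exact absurd hc1.1 (hlst v)

/-- If the legal sequences have bounded length, then any of them extends to a stabilising one. -/
lemma IsLegal.exists_stabilizing {l : List V} {s : Stage V} (hl : IsLegal R τ s l) {N : ℕ}
    (hN : ∀ l, IsLegal R τ s l → l.length ≤ N) :
    ∃ c, IsLegal R τ s (l ++ c) ∧ IsStable R (run τ s (l ++ c)) := by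
  by_contra! hcon
  have : ∀ n, ∃ c : List V, c.length = n ∧ IsLegal R τ s (l ++ c) := by
    intro n
    induction n with
    | zero => exact ⟨[], rfl, by simpa using hl⟩
    | succ n ih =>
      obtain ⟨c, hc, hlc⟩ := ih
      have := hcon c hlc
      simp only [IsStable, not_forall, not_not] at this
      obtain ⟨v, hv⟩ := this
      refine ⟨c ++ [v], by simp [hc], ?_⟩
      rw [← List.append_assoc, isLegal_append]
      exact ⟨hlc, hv, trivial⟩
  obtain ⟨c, hc, hlc⟩ := this (N + 1)
  have := hN _ hlc
  rw [List.length_append] at this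
  omega

/-! ### Particle counts -/

/-- A particle jumping from a vertex of `F` may leave `F`, but none can enter. -/
lemma sum_count_topple_le (F : Finset V) {x : V} (hxF : x ∈ F) {s : Stage V}
    (hx : 0 < (s.1 x).numActive) :
    ∑ z ∈ F, ((topple τ x s).1 z).count ≤ ∑ z ∈ F, (s.1 z).count := by
  have key : ∀ z ∈ F, ((topple τ x s).1 z).count +
      (if z = x ∧ τ (x, s.2 x) ≠ .sleep then 1 else 0) =
      (s.1 z).count + (if τ (x, s.2 x) = .jump z then 1 else 0) := by
    intro z _
    rw [topple_fst_apply]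
    exact count_localEffect x z _ _ (fun h => h ▸ hx)
  have hsum := Finset.sum_congr rfl key
  rw [Finset.sum_add_distrib, Finset.sum_add_distrib] at hsum
  have hle : ∑ z ∈ F, (if τ (x, s.2 x) = .jump z then 1 else 0) ≤
      ∑ z ∈ F, (if z = x ∧ τ (x, s.2 x) ≠ .sleep then 1 else 0) := by
    rcases hI : τ (x, s.2 x) with _ | y
    · simp
    · simp [hxF, eq_comm]
      split_ifs <;> simp
  omega

lemma IsLegal.sum_count_run_le (F : Finset V) {s : Stage V} {l : List V} (hl : IsLegal R τ s l)
    (hlF : ∀ v ∈ l, v ∈ F) :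
    ∑ z ∈ F, ((run τ s l).1 z).count ≤ ∑ z ∈ F, (s.1 z).count := by
  induction l generalizing s with
  | nil => exact le_rfl
  | cons v l ih =>
    exact (ih hl.2 fun w hw => hlF w (List.mem_cons_of_mem _ hw)).trans
      (sum_count_topple_le F (hlF v List.mem_cons_self) (R.pos _ _ hl.1))

/-- The jumps from `x` to `y` made so far are accounted for by the particles at `y` and by the
topplings of `y`. -/
lemma IsLegal.card_jumps_le {x y : V} (hxy : x ≠ y) {s : Stage V} {l : List V}
    (hl : IsLegal R τ s l)
    (h0 : ((Finset.range (s.2 x)).filter fun j => τ (x, j) = .jump y).card ≤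
      (s.1 y).count + s.2 y) :
    ((Finset.range ((run τ s l).2 x)).filter fun j => τ (x, j) = .jump y).card ≤
      ((run τ s l).1 y).count + (run τ s l).2 y := by
  induction l generalizing s with
  | nil => exact h0
  | cons v l ih =>
    refine ih hl.2 ?_
    have hc := count_localEffect v y (τ (v, s.2 v)) (s.1 y) (fun h => h ▸ R.pos _ _ hl.1)
    rw [topple_fst_apply, topple_snd_apply, topple_snd_apply]
    by_cases hvx : x = v
    · subst hvx
      rw [if_pos rfl, if_neg hxy.symm, Finset.range_add_one, Finset.filter_insert]
      rw [if_neg (fun h => hxy.symm h.1)] at hc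
      split_ifs with hj
      · rw [Finset.card_insert_of_notMem (by simp)]
        rw [if_pos hj] at hc
        omega
      · rw [if_neg hj] at hc
        omega
    · rw [if_neg hvx, add_zero]
      by_cases hyv : y = v
      · rw [if_pos hyv]
        split_ifs at hc <;> omega
      · rw [if_neg (fun h => hyv h.1)] at hc
        rw [if_neg hyv]
        omega

end Discrete

section Discrete

variable {V : Type*} {R R' : ToppleRule V} {τ τ' : V × ℕ → Instruction V} {η : V → Bool}

/-! ### The initial stage, and monotonicity -/

/-- The initial configuration `η` restricted to `K`, with no instruction used. -/
def initStage (η : V → Bool) (K : Set V) : Stage V :=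
  (fun x => .active (if x ∈ K ∧ η x = true then 1 else 0), fun _ => 0)

/-- Equal counters make both stages read the same instructions, and legality in the smaller stage
provides the activity that monotonicity requires. -/
lemma IsLegal.of_below {s s' : Stage V} (h1 : ∀ z, (s.1 z).Below (s'.1 z)) (h2 : s.2 = s'.2)
    {l : List V} (hl : IsLegal R τ s l) :
    IsLegal R τ s' l ∧ ∀ z, ((run τ s l).1 z).Below ((run τ s' l).1 z) := by
  induction l generalizing s s' with
  | nil => exact ⟨trivial, h1⟩
  | cons v l ih =>
    have := ih (s := topple τ v s) (s' := topple τ v s') (fun z => ?_) ?_ hl.2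
    · exact ⟨⟨R.mono _ _ _ (h1 v).1 hl.1, this.1⟩, this.2⟩
    · rw [topple_fst_apply, topple_fst_apply, ← h2]
      exact Below.localEffect _ (h1 z) fun e => e ▸ R.pos _ _ hl.1
    · simp only [topple, h2]

lemma initStage_below {K K' : Set V} (h : K ⊆ K') (z : V) :
    ((initStage η K).1 z).Below ((initStage η K').1 z) := by
  have : (if z ∈ K ∧ η z = true then 1 else 0) ≤ if z ∈ K' ∧ η z = true then 1 else 0 := by
    by_cases hz : z ∈ K ∧ η z = true
    · rw [if_pos hz, if_pos ⟨h hz.1, hz.2⟩]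
    · rw [if_neg hz]; exact Nat.zero_le _
  exact ⟨this, this⟩

lemma IsLegal.initStage_mono {K K' : Set V} (h : K ⊆ K') {l : List V}
    (hl : IsLegal R τ (initStage η K) l) : IsLegal R τ (initStage η K') l :=
  (hl.of_below (initStage_below h) rfl).1

lemma run_initStage_snd (K : Set V) (l : List V) (z : V) :
    (run τ (initStage η K) l).2 z = l.count z := by
  simp [run_snd_apply, initStage]

lemma count_initStage (K : Set V) (z : V) :
    ((initStage η K).1 z).count = if z ∈ K ∧ η z = true then 1 else 0 := rfl

lemma IsLegal.mem_of_on {K : Set V} {s : Stage V} {l : List V}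
    (hl : IsLegal (.on K) τ s l) : ∀ v ∈ l, v ∈ K := by
  induction l generalizing s with
  | nil => simp
  | cons v l ih =>
    intro w hw
    rcases List.mem_cons.1 hw with rfl | hw
    · exact hl.1.1
    · exact ih hl.2 w hw

lemma IsLegal.on_of_mem {K : Set V} {s : Stage V} {l : List V}
    (hl : IsLegal (.on Set.univ) τ s l) (hK : ∀ v ∈ l, v ∈ K) : IsLegal (.on K) τ s l := by
  induction l generalizing s with
  | nil => trivial
  | cons v l ih =>
    exact ⟨⟨hK v List.mem_cons_self, hl.1.2⟩,
      ih hl.2 fun w hw => hK w (List.mem_cons_of_mem _ hw)⟩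

lemma IsLegal.on_of_keepOne {K : Set V} {x : V} {s : Stage V} {l : List V}
    (hl : IsLegal (.keepOne K x) τ s l) : IsLegal (.on K) τ s l :=
  hl.imp fun _ _ h => ⟨h.1, h.2.1⟩

/-- The additional 1 comes from enlarging `K` by `y`, which may lie outside `K` and collect the
particles that exit. -/
lemma IsLegal.count_run_le (K : Finset V) {l : List V}
    (hl : IsLegal (.on (K : Set V)) τ (initStage η K) l) (y : V) :
    ((run τ (initStage η K) l).1 y).count ≤ K.card + 1 := by
  have h1 := hl.sum_count_run_le (insert y K)
    fun v hv => Finset.mem_insert_of_mem (hl.mem_of_on v hv)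
  have h2 : ∑ z ∈ insert y K, ((initStage η (K : Set V)).1 z).count ≤ (insert y K).card := by
    rw [Finset.card_eq_sum_ones]
    refine Finset.sum_le_sum fun z _ => ?_
    rw [count_initStage]
    split_ifs <;> simp
  have h3 := Finset.single_le_sum
    (f := fun z => ((run τ (initStage η (K : Set V)) l).1 z).count)
    (fun _ _ => Nat.zero_le _) (Finset.mem_insert_self y K)
  exact (h3.trans h1).trans (h2.trans (Finset.card_insert_le _ _))

/-! ### Stabilisation in finite sets -/

/-- At each vertex, the instruction to jump to a given neighbour occurs infinitely often. -/
def Recurrent (G : SimpleGraph V) (τ : V × ℕ → Instruction V) : Prop :=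
  ∀ x y, G.Adj x y → {j | τ (x, j) = .jump y}.Infinite

lemma exists_le_card_filter_range {p : ℕ → Prop} (h : {j | p j}.Infinite) (N : ℕ) :
    ∃ n, ∀ m, n ≤ m → N ≤ ((Finset.range m).filter p).card := by
  obtain ⟨t, ht, hc⟩ := h.exists_subset_card_eq N
  refine ⟨t.sup id + 1, fun m hm => ?_⟩
  rw [← hc]
  refine Finset.card_le_card fun j hj => ?_
  rw [Finset.mem_filter, Finset.mem_range]
  exact ⟨lt_of_lt_of_le (Nat.lt_succ_of_le (Finset.le_sup (f := id) hj)) hm, ht hj⟩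

lemma IsLegal.card_jumps_le_initStage {K : Set V} {x y : V} (hxy : x ≠ y) {l : List V}
    (hl : IsLegal R τ (initStage η K) l) :
    ((Finset.range (l.count x)).filter fun j => τ (x, j) = .jump y).card ≤
      ((run τ (initStage η K) l).1 y).count + l.count y := by
  have := hl.card_jumps_le hxy (by simp [initStage])
  rwa [run_initStage_snd, run_initStage_snd] at this

variable {G : SimpleGraph V}

/-- Bounds on the topplings propagate backwards along a walk from `x` to a vertex outside `K`, which
is never toppled: many topplings of a vertex send many particles to the next one, and these must
either stay there or be toppled on. -/
lemma Recurrent.exists_length_bound [Infinite V] (hG : G.Connected) (hτ : Recurrent G τ)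
    (η : V → Bool) (K : Finset V) :
    ∃ N, ∀ l, IsLegal (.on (K : Set V)) τ (initStage η K) l → l.length ≤ N := by
  have hb : ∀ x, ∃ U, ∀ l, IsLegal (.on (K : Set V)) τ (initStage η K) l → l.count x ≤ U := by
    obtain ⟨y₀, hy₀⟩ := Infinite.exists_notMem_finset K
    intro x
    obtain ⟨p⟩ := hG.preconnected x y₀
    induction p with
    | nil =>
      refine ⟨0, fun l hl => ?_⟩
      rw [List.count_eq_zero_of_not_mem fun h => hy₀ (hl.mem_of_on _ h)]
    | @cons x y _ hxy _ ih =>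
      obtain ⟨U, hU⟩ := ih hy₀
      -- One more jump to `y` than the `K.card + 1` particles that fit there plus its at most `U`
      -- topplings can account for.
      obtain ⟨n, hn⟩ := exists_le_card_filter_range (hτ x y hxy) (K.card + 1 + U + 1)
      refine ⟨n, fun l hl => ?_⟩
      by_contra! hlt
      have h1 := hn _ hlt.le
      have h2 := hl.card_jumps_le_initStage hxy.ne
      have h3 := hl.count_run_le K y
      have h4 := hU l hl
      omega
  choose U hU using hb
  refine ⟨∑ x ∈ K, U x, fun l hl => ?_⟩
  rw [← List.sum_toFinset_count_eq_length]
  have hsub : l.toFinset ⊆ K := fun v hv => hl.mem_of_on v (List.mem_toFinset.1 hv)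
  exact (Finset.sum_le_sum_of_subset hsub).trans (Finset.sum_le_sum fun x _ => hU x l hl)

/-! ### Stabilisation with one active particle kept at a vertex -/

/-- Some particle of `η` in `K` or `x` gets to `x` when the topplings are restricted to `K`. -/
def Visited (η : V → Bool) (τ : V × ℕ → Instruction V) (K : Set V) (x : V) : Prop :=
  ∃ l, IsLegal (.keepOne K x) τ (initStage η K) l ∧
    0 < ((run τ (initStage η K) l).1 x).numActive

/-- The topplings of `l` stabilise `K`, except that one active particle is kept at `x`. -/
def KeepsOne (η : V → Bool) (τ : V × ℕ → Instruction V) (K : Set V) (x : V) (l : List V) : Prop :=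
  IsLegal (.keepOne K x) τ (initStage η K) l ∧
    IsStable (.keepOne K x) (run τ (initStage η K) l) ∧
    0 < ((run τ (initStage η K) l).1 x).numActive

lemma Visited.mono {K K' : Set V} (h : K ⊆ K') {x : V} (hv : Visited η τ K x) :
    Visited η τ K' x := by
  obtain ⟨l, hl, hx⟩ := hv
  obtain ⟨h1, h2⟩ := hl.of_below (initStage_below h) rfl
  exact ⟨l, h1.imp fun v n h' => ⟨h h'.1, h'.2⟩, hx.trans_le (h2 x).1⟩

lemma IsLegal.numActive_pos_of_keepOne {K : Set V} {x : V} {s : Stage V} {l : List V}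
    (hl : IsLegal (.keepOne K x) τ s l) (hx : 0 < (s.1 x).numActive) :
    0 < ((run τ s l).1 x).numActive := by
  induction l generalizing s with
  | nil => exact hx
  | cons v l ih =>
    refine ih hl.2 ?_
    rw [topple_fst_apply]
    by_cases hxv : x = v
    · exact one_le_numActive_localEffect _ _ (hxv ▸ hl.1.2.2 hxv.symm)
    · exact hx.trans_le (numActive_le_localEffect hxv _ _)

lemma Visited.exists_keepsOne [Infinite V] (hG : G.Connected) (hτ : Recurrent G τ) {K : Finset V}
    {x : V} (hv : Visited η τ K x) : ∃ l, KeepsOne η τ K x l := by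
  obtain ⟨l, hl, hx⟩ := hv
  obtain ⟨N, hN⟩ := hτ.exists_length_bound hG η K
  obtain ⟨c, hc, hst⟩ := hl.exists_stabilizing fun l hl => hN l hl.on_of_keepOne
  refine ⟨l ++ c, hc, hst, ?_⟩
  rw [run_append]
  exact (isLegal_append.1 hc).2.numActive_pos_of_keepOne hx

/-- The index of the first unread instruction at `x` is thus well defined, and the events that fix
its value are disjoint. -/
lemma KeepsOne.count_eq {K : Set V} {x : V} {l l' : List V} (h : KeepsOne η τ K x l)
    (h' : KeepsOne η τ K x l') (z : V) : l.count z = l'.count z := by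
  have := congrArg (fun s => s.2 z) (h.1.run_eq_of_isStable h'.1 h.2.1 h'.2.1)
  simpa only [run_initStage_snd] using this

/-- Stability under the restricted rule leaves exactly one active particle at `x`. If the next
instruction puts it to sleep, no other vertex changes, so `K` becomes stable for the unrestricted
rule. -/
lemma KeepsOne.exists_sleeping {K : Set V} {x : V} (hx : x ∈ K) {l : List V}
    (h : KeepsOne η τ K x l) (hs : τ (x, l.count x) = .sleep) :
    ∃ b, IsLegal (.on K) τ (initStage η K) b ∧ IsStable (.on K) (run τ (initStage η K) b) ∧
      (run τ (initStage η K) b).1 x = .sleeping := by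
  obtain ⟨hl, hst, hpos⟩ := h
  have hone : (run τ (initStage η K) l).1 x = .active 1 := by
    have h1 := hst x
    simp only [ToppleRule.keepOne, not_and] at h1
    have h2 := h1 hx hpos
    rcases hsx : (run τ (initStage η K) l).1 x with _ | n
    · simp [hsx, SiteState.numActive] at hpos
    · simp only [hsx, SiteState.numActive] at hpos h2
      simp at h2
      congr 1
      omega
  have heff : ∀ z, (run τ (initStage η K) (l ++ [x])).1 z =
      if z = x then .sleeping else (run τ (initStage η K) l).1 z := by
    intro z
    rw [run_append, run, run, topple_fst_apply, run_initStage_snd, hs]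
    by_cases hz : z = x
    · subst hz; simp [localEffect, hone, SiteState.trySleep]
    · simp [localEffect, hz]
  refine ⟨l ++ [x], isLegal_append.2 ⟨hl.on_of_keepOne, ⟨hx, hpos⟩, trivial⟩, fun v hv => ?_, ?_⟩
  · rw [heff] at hv
    by_cases hvx : v = x
    · simp [hvx, ToppleRule.on, SiteState.numActive] at hv
    · rw [if_neg hvx] at hv
      exact hst v ⟨hv.1, hv.2, fun e => absurd e hvx⟩
  · rw [heff, if_pos rfl]

/-- The vertices where the kept particle falls asleep at once are at most as numerous as the
initial particles. -/
lemma card_sleepers_le {K X : Finset V} (hXK : X ⊆ K)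
    (hX : ∀ x ∈ X, ∃ l, KeepsOne η τ K x l ∧ τ (x, l.count x) = .sleep) :
    X.card ≤ (K.filter fun x => η x = true).card := by
  rcases X.eq_empty_or_nonempty with rfl | ⟨x₀, hx₀⟩
  · simp
  obtain ⟨l₀, h₀, hs₀⟩ := hX x₀ hx₀
  obtain ⟨b₀, hb₀, hst₀, -⟩ := h₀.exists_sleeping (hXK hx₀) hs₀
  -- The stabilising sequence obtained for `x` depends on `x`, but its final configuration does not,
  -- by the abelian property.
  have hsl : ∀ x ∈ X, (run τ (initStage η (K : Set V)) b₀).1 x = .sleeping := by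
    intro x hx
    obtain ⟨l, h, hs⟩ := hX x hx
    obtain ⟨b, hb, hst, hbx⟩ := h.exists_sleeping (hXK hx) hs
    rw [hb₀.run_eq_of_isStable hb hst₀ hst, hbx]
  have h1 := hb₀.sum_count_run_le K fun v hv => hb₀.mem_of_on v hv
  calc X.card = ∑ z ∈ X, ((run τ (initStage η (K : Set V)) b₀).1 z).count := by
        rw [Finset.card_eq_sum_ones]
        exact Finset.sum_congr rfl fun x hx => by rw [hsl x hx]; rfl
    _ ≤ ∑ z ∈ K, ((run τ (initStage η (K : Set V)) b₀).1 z).count :=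
        Finset.sum_le_sum_of_subset hXK
    _ ≤ _ := h1
    _ = _ := by
        rw [Finset.card_filter]
        refine Finset.sum_congr rfl fun z hz => ?_
        rw [count_initStage]
        simp [hz]

/-! ### Vertices toppled arbitrarily often -/

/-- Starting from finitely many particles of `η`, `x` may be toppled arbitrarily often. -/
def Unbounded (η : V → Bool) (τ : V × ℕ → Instruction V) (x : V) : Prop :=
  ∀ N, ∃ (Λ : Finset V) (l : List V),
    IsLegal (.on Set.univ) τ (initStage η Λ) l ∧ N ≤ l.count x

/-- Stabilise a finite set containing `y`: at most one particle then remains at `y`, so nearly all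
the particles sent from `x` were toppled on from `y`. -/
lemma Unbounded.of_adj [Infinite V] (hG : G.Connected) (hτ : Recurrent G τ) {x y : V}
    (hxy : G.Adj x y) (hx : Unbounded η τ x) : Unbounded η τ y := by
  intro N
  -- One extra jump, because one arrived particle may remain at `y`.
  obtain ⟨n, hn⟩ := exists_le_card_filter_range (hτ x y hxy) (N + 1)
  obtain ⟨Λ, l, hl, hlx⟩ := hx n
  set K : Finset V := insert y (Λ ∪ l.toFinset) with hK
  have hΛK : (Λ : Set V) ⊆ K := fun z hz => by
    have : z ∈ Λ := hz
    simp [hK, this]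
  have hlK : IsLegal (.on (K : Set V)) τ (initStage η K) l :=
    (hl.initStage_mono hΛK).on_of_mem fun v hv => by simp [hK, hv]
  obtain ⟨M, hM⟩ := hτ.exists_length_bound hG η K
  obtain ⟨c, hc, hst⟩ := hlK.exists_stabilizing hM
  refine ⟨K, l ++ c, hc.imp fun v n h => ⟨trivial, h.2⟩, ?_⟩
  have h1 := hc.card_jumps_le_initStage hxy.ne
  have h2 := hn ((l ++ c).count x) (by rw [List.count_append]; omega)
  have h3 : ((run τ (initStage η (K : Set V)) (l ++ c)).1 y).count ≤ 1 := by
    have := hst y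
    rcases hs : (run τ (initStage η (K : Set V)) (l ++ c)).1 y with _ | m
    · simp [SiteState.count]
    · rw [hs] at this
      simp only [ToppleRule.on, not_and, SiteState.numActive] at this
      have := this (by simp [hK])
      simp only [SiteState.count]
      omega
  omega

lemma Unbounded.all [Infinite V] (hG : G.Connected) (hτ : Recurrent G τ) {x : V}
    (hx : Unbounded η τ x) (y : V) : Unbounded η τ y := by
  obtain ⟨p⟩ := hG.preconnected x y
  induction p with
  | nil => exact hx
  | cons hxy _ ih => exact ih (hx.of_adj hG hτ hxy)

/-- Stop as soon as `x` holds an active particle: up to then `x` is not toppled, so the restriction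
at `x` is respected. -/
lemma IsLegal.exists_prefix_numActive_pos {K : Set V} {x : V} {s : Stage V} {l : List V}
    (hl : IsLegal (.on K) τ s l) (hx : x ∈ l) :
    ∃ l', IsLegal (.keepOne K x) τ s l' ∧ 0 < ((run τ s l').1 x).numActive := by
  induction l generalizing s with
  | nil => simp at hx
  | cons v l ih =>
    by_cases hpos : 0 < (s.1 x).numActive
    · exact ⟨[], trivial, hpos⟩
    · have hvx : v ≠ x := by
        rintro rfl
        exact hpos hl.1.2
      obtain ⟨l', h1, h2⟩ := ih hl.2 (by simpa [hvx.symm] using hx)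
      exact ⟨v :: l', ⟨⟨hl.1.1, hl.1.2, fun e => absurd e hvx⟩, h1⟩, h2⟩

lemma Unbounded.exists_visited {x : V} (hx : Unbounded η τ x) :
    ∃ K : Finset V, Visited η τ K x := by
  obtain ⟨Λ, l, hl, hlx⟩ := hx 1
  refine ⟨Λ ∪ l.toFinset, ?_⟩
  have h1 : IsLegal (.on ((Λ ∪ l.toFinset : Finset V) : Set V)) τ
      (initStage η (Λ ∪ l.toFinset : Finset V)) l :=
    (hl.initStage_mono (by simp)).on_of_mem fun v hv => by simp [hv]
  exact h1.exists_prefix_numActive_pos (List.count_pos_iff.1 hlx)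

/-! ### Locality -/

/-- Only the entries between the initial and final counters of each stack are read. -/
lemma run_congr {s : Stage V} {l : List V}
    (h : ∀ y i, s.2 y ≤ i → i < s.2 y + l.count y → τ (y, i) = τ' (y, i)) :
    run τ s l = run τ' s l ∧ (IsLegal R τ s l ↔ IsLegal R τ' s l) := by
  induction l generalizing s with
  | nil => exact ⟨rfl, Iff.rfl⟩
  | cons v l ih =>
    have hv : topple τ v s = topple τ' v s := by
      simp only [topple, h v (s.2 v) le_rfl (by simp)]
    have := ih (s := topple τ v s) fun y i h1 h2 => h y i ?_ ?_
    · rw [run, run, IsLegal, IsLegal, ← hv, this.1, this.2]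
      exact ⟨rfl, Iff.rfl⟩
    · rw [topple_snd_apply] at h1
      omega
    · rw [topple_snd_apply] at h2
      rw [List.count_cons]
      by_cases hyv : y = v
      · subst hyv
        simp at h2 ⊢
        omega
      · rw [if_neg hyv] at h2
        omega

lemma initStage_congr {η η' : V → Bool} {K : Set V} (h : ∀ x ∈ K, η x = η' x) :
    initStage η K = initStage η' K := by
  refine Prod.ext (funext fun x => ?_) rfl
  by_cases hx : x ∈ K
  · simp [initStage, h x hx]
  · simp [initStage, hx]

/-! ### Relabelling the vertices -/

/-- The instruction after a relabelling of the vertices. -/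
def Instruction.relabel {W : Type*} (φ : V → W) : Instruction V → Instruction W
  | .sleep => .sleep
  | .jump y => .jump (φ y)

/-- The instructions after a relabelling of the vertices. -/
def relabelStacks (φ : V ≃ V) (τ : V × ℕ → Instruction V) (p : V × ℕ) : Instruction V :=
  (τ (φ.symm p.1, p.2)).relabel φ

/-- The stage after a relabelling of the vertices. -/
def Stage.relabel (φ : V ≃ V) (s : Stage V) : Stage V := (s.1 ∘ φ.symm, s.2 ∘ φ.symm)

lemma localEffect_relabel (φ : V ≃ V) (x : V) (i : Instruction V) (z : V) (s : SiteState) :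
    localEffect (φ x) (i.relabel φ) z s = localEffect x i (φ.symm z) s := by
  cases i <;> simp [localEffect, Instruction.relabel, ← Equiv.symm_apply_eq]

lemma topple_relabel (φ : V ≃ V) (x : V) (s : Stage V) :
    topple (relabelStacks φ τ) (φ x) (s.relabel φ) = (topple τ x s).relabel φ := by
  refine Prod.ext (funext fun z => ?_) (funext fun z => ?_)
  · simp only [topple_fst_apply, Stage.relabel, Function.comp_apply, relabelStacks,
      Equiv.symm_apply_apply, localEffect_relabel]
  · simp only [topple_snd_apply, Stage.relabel, Function.comp_apply, Equiv.symm_apply_eq]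

lemma run_relabel (φ : V ≃ V) (s : Stage V) (l : List V) :
    run (relabelStacks φ τ) (s.relabel φ) (l.map φ) = (run τ s l).relabel φ := by
  induction l generalizing s with
  | nil => rfl
  | cons v l ih => rw [List.map_cons, run, topple_relabel, ih, run]

lemma isLegal_keepOne_relabel (φ : V ≃ V) (K : Set V) (x : V) (s : Stage V) (l : List V) :
    IsLegal (.keepOne (φ '' K) (φ x)) (relabelStacks φ τ) (s.relabel φ) (l.map φ) ↔
      IsLegal (.keepOne K x) τ s l := by
  induction l generalizing s with
  | nil => exact Iff.rfl
  | cons v l ih =>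
    rw [List.map_cons, IsLegal, IsLegal, topple_relabel, ih]
    simp [ToppleRule.keepOne, Stage.relabel]

lemma initStage_relabel (φ : V ≃ V) (K : Set V) :
    initStage (η ∘ φ.symm) (φ '' K) = (initStage η K).relabel φ := by
  refine Prod.ext (funext fun z => ?_) rfl
  simp [initStage, Stage.relabel, Equiv.image_eq_preimage_symm]

lemma visited_relabel (φ : V ≃ V) (K : Set V) (x : V) :
    Visited (η ∘ φ.symm) (relabelStacks φ τ) (φ '' K) (φ x) ↔ Visited η τ K x := by
  have hsurj : Function.Surjective (List.map φ) := List.map_surjective_iff.2 φ.surjective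
  unfold Visited
  rw [hsurj.exists]
  simp only [initStage_relabel, isLegal_keepOne_relabel, run_relabel]
  simp [Stage.relabel]

end Discrete

/-! ### Product measures -/

section ProductMeasures

variable {ι α β X : Type*} [MeasurableSpace X] [MeasurableSpace α] [MeasurableSpace β]

/-- In a product space, an event that does not depend on a coordinate is independent of it. -/
lemma infinitePi_inter_eval (μ : ι → Measure X) [∀ i, IsProbabilityMeasure (μ i)] (i : ι)
    {C : Set (ι → X)} (hC : MeasurableSet C)
    (hinv : ∀ ω ω', (∀ j ≠ i, ω j = ω' j) → ω ∈ C → ω' ∈ C) {E : Set X} (hE : MeasurableSet E) :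
    Measure.infinitePi μ (C ∩ {ω | ω i ∈ E}) = Measure.infinitePi μ C * μ i E := by
  have hne : Nonempty X := nonempty_of_isProbabilityMeasure (μ i)
  obtain ⟨c⟩ := hne
  have hind : iIndepFun (fun (j : ι) (ω : ι → X) => ω j) (Measure.infinitePi μ) :=
    iIndepFun_infinitePi (X := fun _ x => x) fun _ => measurable_id
  have h := indep_iSup_of_disjoint (S := {i}ᶜ) (T := {i})
    (m := fun j => MeasurableSpace.comap (fun ω : ι → X => ω j) inferInstance)
    (fun j => (measurable_pi_apply j).comap_le) hind disjoint_compl_left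
  rw [Indep_iff] at h
  have hCm : MeasurableSet[⨆ j ∈ ({i}ᶜ : Set ι),
      MeasurableSpace.comap (fun ω : ι → X => ω j) inferInstance] C := by
    -- Resetting coordinate `i` to `c` is measurable for the σ-algebra of the other coordinates, and
    -- `C` is its own preimage under this map by `hinv`.
    have hf : @Measurable _ _ (⨆ j ∈ ({i}ᶜ : Set ι),
        MeasurableSpace.comap (fun ω : ι → X => ω j) inferInstance) _
        (fun ω : ι → X => Function.update ω i c) := by
      refine @measurable_pi_lambda _ _ _ (_) _ _ fun j => ?_
      by_cases hj : j = i
      · subst hj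
        simp only [Function.update_self]
        exact @measurable_const _ _ _ (_) _
      · simp only [Function.update_of_ne hj]
        exact (comap_measurable (fun ω : ι → X => ω j)).mono
          (le_iSup₂_of_le (f := fun j (_ : j ∈ ({i}ᶜ : Set ι)) =>
            MeasurableSpace.comap (fun ω : ι → X => ω j) inferInstance) j hj le_rfl) le_rfl
    have := hf hC
    rwa [show (fun ω : ι → X => Function.update ω i c) ⁻¹' C = C from
      Set.ext fun ω => ⟨hinv _ _ fun j hj => Function.update_of_ne hj _ _,
        hinv _ _ fun j hj => (Function.update_of_ne hj _ _).symm⟩] at this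
  have hEm : MeasurableSet[⨆ j ∈ ({i} : Set ι),
      MeasurableSpace.comap (fun ω : ι → X => ω j) inferInstance] {ω : ι → X | ω i ∈ E} := by
    refine (le_iSup₂_of_le (f := fun j (_ : j ∈ ({i} : Set ι)) =>
      MeasurableSpace.comap (fun ω : ι → X => ω j) inferInstance) i rfl le_rfl) _ ⟨E, hE, rfl⟩
  rw [h _ _ hCm hEm]
  congr 1
  rw [← Measure.infinitePi_map_eval μ i, Measure.map_apply (measurable_pi_apply i) hE]
  rfl

lemma prod_infinitePi_inter_eval (P : Measure α) [SFinite P] (μ : ι → Measure X)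
    [∀ i, IsProbabilityMeasure (μ i)] (i : ι)
    {C : Set (α × (ι → X))} (hC : MeasurableSet C)
    (hinv : ∀ a ω ω', (∀ j ≠ i, ω j = ω' j) → (a, ω) ∈ C → (a, ω') ∈ C) {E : Set X}
    (hE : MeasurableSet E) :
    P.prod (Measure.infinitePi μ) (C ∩ {p | p.2 i ∈ E}) =
      P.prod (Measure.infinitePi μ) C * μ i E := by
  have hEm : MeasurableSet {p : α × (ι → X) | p.2 i ∈ E} :=
    ((measurable_pi_apply i).comp measurable_snd) hE
  rw [Measure.prod_apply (hC.inter hEm), Measure.prod_apply hC,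
    ← lintegral_mul_const _ (measurable_measure_prodMk_left hC)]
  refine lintegral_congr fun a => ?_
  exact infinitePi_inter_eval μ i (measurable_prodMk_left hC) (hinv a) hE

lemma infinitePi_prod_inter_eval (μ : ι → Measure X) [∀ i, IsProbabilityMeasure (μ i)]
    (P : Measure α) [SFinite P] (i : ι)
    {C : Set ((ι → X) × α)} (hC : MeasurableSet C)
    (hinv : ∀ a ω ω', (∀ j ≠ i, ω j = ω' j) → (ω, a) ∈ C → (ω', a) ∈ C) {E : Set X}
    (hE : MeasurableSet E) :
    (Measure.infinitePi μ).prod P (C ∩ {p | p.1 i ∈ E}) =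
      (Measure.infinitePi μ).prod P C * μ i E := by
  have hEm : MeasurableSet {p : (ι → X) × α | p.1 i ∈ E} :=
    ((measurable_pi_apply i).comp measurable_fst) hE
  rw [Measure.prod_apply_symm (hC.inter hEm), Measure.prod_apply_symm hC,
    ← lintegral_mul_const _ (measurable_measure_prodMk_right hC)]
  refine lintegral_congr fun a => ?_
  exact infinitePi_inter_eval μ i (measurable_prodMk_right hC) (hinv a) hE

/-- Permuting the coordinates and mapping each of them. -/
lemma measurePreserving_infinitePi (μ : ι → Measure X) [∀ i, IsProbabilityMeasure (μ i)]
    (e : ι ≃ ι) {f : X → X} (hf : Measurable f) (h : ∀ i, (μ (e i)).map f = μ i) :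
    MeasurePreserving (fun (ω : ι → X) i => f (ω (e i)))
      (Measure.infinitePi μ) (Measure.infinitePi μ) := by
  refine ⟨measurable_pi_lambda _ fun i => hf.comp (measurable_pi_apply _), ?_⟩
  have h1 := Measure.map_infinitePi_infinitePi_of_inj (P := μ) e.injective
  have h2 := Measure.infinitePi_map_pi (fun i => μ (e i)) (f := fun _ => f) fun _ => hf
  rw [← h1, Measure.map_map (by fun_prop) (by fun_prop)] at h2
  rw [show (fun (ω : ι → X) i => f (ω (e i))) = (fun (ω : ι → X) i => f (ω i)) ∘
    (fun ω i => ω (e i)) from rfl, h2]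
  simp only [h]

/-- An event that depends on finitely many discrete coordinates is measurable. -/
lemma measurableSet_of_finite_dependence {ι' Y : Type*} [MeasurableSpace Y]
    [Countable X] [MeasurableSingletonClass X] [Countable Y] [MeasurableSingletonClass Y]
    (F : Finset ι) (F' : Finset ι') {C : Set ((ι → X) × (ι' → Y))}
    (h : ∀ a a' b b', (∀ i ∈ F, a i = a' i) → (∀ i ∈ F', b i = b' i) →
      ((a, b) ∈ C → (a', b') ∈ C)) : MeasurableSet C := by
  let g : (ι → X) × (ι' → Y) → (F → X) × (F' → Y) :=
    fun p => (fun i => p.1 i, fun i => p.2 i)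
  have hg : Measurable g := by fun_prop
  -- `C` is the preimage of a subset of a countable discrete space, where every set is measurable.
  have hC : C = g ⁻¹' (g '' C) := by
    refine Set.Subset.antisymm (Set.subset_preimage_image _ _) ?_
    rintro ⟨a', b'⟩ ⟨⟨a, b⟩, hab, he⟩
    refine h a a' b b' (fun i hi => ?_) (fun i hi => ?_) hab
    · exact congrFun (congrArg Prod.fst he) ⟨i, hi⟩
    · exact congrFun (congrArg Prod.snd he) ⟨i, hi⟩
  rw [hC]
  exact hg (Set.to_countable _).measurableSet

end ProductMeasures

/-! ### Particles and instructions -/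

section Law

variable {V : Type*}

instance : MeasurableSingletonClass (Instruction V) := ⟨fun _ => trivial⟩

instance [Countable V] : Countable (Instruction V) := by
  refine Function.Injective.countable (f := fun i : Instruction V =>
    match i with
    | .sleep => (none : Option V)
    | .jump y => some y) ?_
  rintro (_ | a) (_ | b) h <;> simp_all

variable (G : SimpleGraph V) [G.LocallyFinite] (lam : ℝ≥0) (μ : I)

/-- The law of the initial particles and of the instructions. -/
def stackLaw : Measure ((V → Bool) × (V × ℕ → Instruction V)) :=
  (Measure.infinitePi fun _ : V => bernoulliMeasure true false μ).prod
    (Measure.infinitePi fun p : V × ℕ => instructionLaw G lam p.1)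

lemma instructionLaw_sleep (x : V) :
    instructionLaw G lam x {.sleep} = ((lam / (1 + lam) : ℝ≥0) : ℝ≥0∞) := by
  simp [instructionLaw, ENNReal.smul_def]

lemma instructionLaw_jump_pos {x y : V} (hxy : G.Adj x y) :
    0 < instructionLaw G lam x {.jump y} := by
  have hd : 0 < G.degree x := (G.degree_pos_iff_exists_adj x).2 ⟨y, hxy⟩
  simp only [instructionLaw, Measure.add_apply, Measure.finsetSum_apply]
  refine lt_of_lt_of_le ?_ (le_add_left (Finset.single_le_sum (f := fun z =>
    ((1 / ((G.degree x : ℝ≥0) * (1 + lam))) • Measure.dirac (Instruction.jump z))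
      {Instruction.jump y}) (fun _ _ => zero_le)
      ((G.mem_neighborFinset x y).2 hxy)))
  have : (0 : ℝ≥0) < 1 / ((G.degree x : ℝ≥0) * (1 + lam)) := by positivity
  simpa [ENNReal.smul_def] using this

lemma bernoulliMeasure_true : bernoulliMeasure true false μ {true} = ENNReal.ofReal μ := by
  rw [bernoulliMeasure_apply _ (MeasurableSet.singleton _)]
  simp only [Set.mem_singleton_iff, if_true, Bool.false_eq_true, if_false]
  exact (ENNReal.ofReal_eq_coe_nnreal μ.2.1).symm

lemma instructionLaw_relabel (φ : G ≃g G) (x : V) :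
    (instructionLaw G lam (φ.symm x)).map (Instruction.relabel φ) = instructionLaw G lam x := by
  have hm : Measurable (Instruction.relabel φ) := fun _ _ => trivial
  have hdeg : G.degree (φ.symm x) = G.degree x := φ.symm.degree_eq x
  ext s hs
  rw [Measure.map_apply hm hs]
  simp only [instructionLaw, Measure.add_apply, Measure.finsetSum_apply, Measure.smul_apply,
    Measure.dirac_apply' _ (show MeasurableSet (_ : Set (Instruction V)) from trivial), hdeg]
  congr 1
  refine Finset.sum_equiv φ.toEquiv (fun y => ?_) fun y _ => rfl
  rw [SimpleGraph.mem_neighborFinset, SimpleGraph.mem_neighborFinset]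
  have := φ.map_adj_iff (v := φ.symm x) (w := y)
  rw [RelIso.apply_symm_apply] at this
  exact this.symm

lemma isProbabilityMeasure_stackLaw (hdeg : ∀ x, 0 < G.degree x) :
    IsProbabilityMeasure (stackLaw G lam μ) := by
  have h1 : ∀ p : V × ℕ, IsProbabilityMeasure (instructionLaw G lam p.1) :=
    fun p => isProbabilityMeasure_instructionLaw G lam p.1 (hdeg p.1)
  unfold stackLaw
  infer_instance

lemma stackLaw_inter_sleep (hdeg : ∀ x, 0 < G.degree x) (x : V) (j : ℕ)
    {C : Set ((V → Bool) × (V × ℕ → Instruction V))} (hC : MeasurableSet C)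
    (hinv : ∀ η τ τ', (∀ p ≠ (x, j), τ p = τ' p) → (η, τ) ∈ C → (η, τ') ∈ C) :
    stackLaw G lam μ (C ∩ {p | p.2 (x, j) = .sleep}) =
      stackLaw G lam μ C * ((lam / (1 + lam) : ℝ≥0) : ℝ≥0∞) := by
  have h1 : ∀ p : V × ℕ, IsProbabilityMeasure (instructionLaw G lam p.1) :=
    fun p => isProbabilityMeasure_instructionLaw G lam p.1 (hdeg p.1)
  rw [← instructionLaw_sleep G lam x]
  exact prod_infinitePi_inter_eval _ (fun p : V × ℕ => instructionLaw G lam p.1) (x, j) hC hinv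
    (MeasurableSet.singleton _)

lemma stackLaw_inter_particle (hdeg : ∀ x, 0 < G.degree x) (x : V)
    {C : Set ((V → Bool) × (V × ℕ → Instruction V))} (hC : MeasurableSet C)
    (hinv : ∀ τ η η', (∀ z ≠ x, η z = η' z) → (η, τ) ∈ C → (η', τ) ∈ C) :
    stackLaw G lam μ (C ∩ {p | p.1 x = true}) =
      stackLaw G lam μ C * ENNReal.ofReal μ := by
  have h1 : ∀ p : V × ℕ, IsProbabilityMeasure (instructionLaw G lam p.1) :=
    fun p => isProbabilityMeasure_instructionLaw G lam p.1 (hdeg p.1)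
  rw [← bernoulliMeasure_true]
  exact infinitePi_prod_inter_eval (fun _ : V => bernoulliMeasure true false μ) _ x hC
    hinv (MeasurableSet.singleton _)

/-- An automorphism preserves degrees and adjacency, hence carries the instruction law at a vertex
to the one at its image. This is how transitivity enters the probabilistic estimates. -/
lemma measurePreserving_relabel (hdeg : ∀ x, 0 < G.degree x) (φ : G ≃g G) :
    MeasurePreserving (fun p : (V → Bool) × (V × ℕ → Instruction V) =>
      (p.1 ∘ φ.symm, relabelStacks φ.toEquiv p.2)) (stackLaw G lam μ) (stackLaw G lam μ) := by
  have h1 : ∀ p : V × ℕ, IsProbabilityMeasure (instructionLaw G lam p.1) :=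
    fun p => isProbabilityMeasure_instructionLaw G lam p.1 (hdeg p.1)
  have hη := measurePreserving_infinitePi (fun _ : V => bernoulliMeasure true false μ)
    φ.toEquiv.symm (f := id) measurable_id fun _ => Measure.map_id
  have hτ := measurePreserving_infinitePi (fun p : V × ℕ => instructionLaw G lam p.1)
    (φ.toEquiv.symm.prodCongr (Equiv.refl ℕ)) (f := Instruction.relabel φ)
    (fun _ _ => trivial) fun p => instructionLaw_relabel G lam φ p.1
  exact hη.prod hτ

lemma ae_recurrent (hdeg : ∀ x, 0 < G.degree x) [Countable V] :
    ∀ᵐ τ ∂(Measure.infinitePi fun p : V × ℕ => instructionLaw G lam p.1), Recurrent G τ := by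
  have h1 : ∀ p : V × ℕ, IsProbabilityMeasure (instructionLaw G lam p.1) :=
    fun p => isProbabilityMeasure_instructionLaw G lam p.1 (hdeg p.1)
  have key : ∀ x y, G.Adj x y → ∀ n,
      ∀ᵐ τ ∂(Measure.infinitePi fun p : V × ℕ => instructionLaw G lam p.1),
        ∃ j, n ≤ j ∧ τ (x, j) = .jump y := by
    intro x y hxy n
    have hprob : IsProbabilityMeasure (instructionLaw G lam x) := h1 (x, 0)
    set r := instructionLaw G lam x {.jump y}ᶜ with hr
    have hr1 : r < 1 := by
      rw [hr, prob_compl_eq_one_sub (MeasurableSet.singleton _)]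
      exact ENNReal.sub_lt_self ENNReal.one_ne_top one_ne_zero
        (instructionLaw_jump_pos G lam hxy).ne'
    rw [ae_iff]
    refine le_antisymm ?_ zero_le
    -- The `m` instructions starting at index `n` all avoid the jump to `y` with probability `r ^
    -- m`.
    refine ge_of_tendsto' (ENNReal.tendsto_pow_atTop_nhds_zero_of_lt_one hr1) fun m => ?_
    have := Measure.infinitePi_pi (fun p : V × ℕ => instructionLaw G lam p.1)
      (s := (Finset.range m).map ⟨fun i => (x, n + i), fun i j h => by simpa using h⟩)
      (t := fun _ => {.jump y}ᶜ) fun _ _ => (MeasurableSet.singleton _).compl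
    rw [Finset.prod_map] at this
    change _ = ∏ _i ∈ Finset.range m, r at this
    rw [Finset.prod_const, Finset.card_range] at this
    rw [← this]
    refine measure_mono fun τ hτ => ?_
    simp only [Set.mem_ofPred_eq, not_exists, not_and] at hτ
    intro p hp
    simp only [Finset.coe_map, Set.mem_image] at hp
    obtain ⟨i, -, rfl⟩ := hp
    exact hτ _ (Nat.le_add_right _ _)
  have : ∀ᵐ τ ∂(Measure.infinitePi fun p : V × ℕ => instructionLaw G lam p.1),
      ∀ x y, ∀ n, G.Adj x y → ∃ j, n ≤ j ∧ τ (x, j) = .jump y := by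
    rw [ae_all_iff]; intro x
    rw [ae_all_iff]; intro y
    rw [ae_all_iff]; intro n
    by_cases hxy : G.Adj x y
    · filter_upwards [key x y hxy n] with τ hτ _ using hτ
    · exact ae_of_all _ fun τ h => absurd h hxy
  filter_upwards [this] with τ hτ x y hxy
  refine Set.infinite_of_forall_exists_gt fun n => ?_
  obtain ⟨j, hj, hj'⟩ := hτ x y (n + 1) hxy
  exact ⟨j, hj', hj⟩

end Law

/-! ### Visit events and the expected number of sleepers -/

section Events

variable {V : Type*}

/-- The indices of the instructions used by a list of topplings. -/
def usedIndices (l : List V) : Finset (V × ℕ) :=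
  l.toFinset.biUnion fun y =>
    (Finset.range (l.count y)).map ⟨fun i => (y, i), fun i j h => by simpa using h⟩

lemma mem_usedIndices {l : List V} {p : V × ℕ} : p ∈ usedIndices l ↔ p.2 < l.count p.1 := by
  obtain ⟨y, i⟩ := p
  simp only [usedIndices, Finset.mem_biUnion, List.mem_toFinset, Finset.mem_map,
    Finset.mem_range]
  constructor
  · rintro ⟨_, -, _, h, he⟩
    cases he
    exact h
  · intro h
    exact ⟨y, List.count_pos_iff.1 (Nat.zero_lt_of_lt h), i, h, rfl⟩

lemma run_initStage_congr {R : ToppleRule V} {η η' : V → Bool} {τ τ' : V × ℕ → Instruction V}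
    {K : Set V} {l : List V} (hη : ∀ x ∈ K, η x = η' x) (hτ : ∀ p ∈ usedIndices l, τ p = τ' p) :
    run τ (initStage η K) l = run τ' (initStage η' K) l ∧
      (IsLegal R τ (initStage η K) l ↔ IsLegal R τ' (initStage η' K) l) := by
  rw [← initStage_congr hη]
  refine run_congr fun y i _ hi => hτ _ (mem_usedIndices.2 ?_)
  simpa [initStage] using hi

lemma KeepsOne.congr {η η' : V → Bool} {τ τ' : V × ℕ → Instruction V}
    {K : Set V} {x : V} {l : List V} (hη : ∀ x ∈ K, η x = η' x)
    (hτ : ∀ p ∈ usedIndices l, τ p = τ' p) (h : KeepsOne η τ K x l) : KeepsOne η' τ' K x l := by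
  obtain ⟨h1, h2⟩ := run_initStage_congr (R := .keepOne K x) hη hτ
  exact ⟨h2.1 h.1, h1 ▸ h.2.1, h1 ▸ h.2.2⟩

lemma mem_of_mem_usedIndices {τ : V × ℕ → Instruction V} {K : Set V} {s : Stage V}
    {x : V} {l : List V} (hl : IsLegal (.keepOne K x) τ s l) {p : V × ℕ}
    (hp : p ∈ usedIndices l) : p.1 ∈ K :=
  hl.on_of_keepOne.mem_of_on _ (List.count_pos_iff.1 (Nat.zero_lt_of_lt (mem_usedIndices.1 hp)))

lemma Visited.congr {η η' : V → Bool} {τ τ' : V × ℕ → Instruction V}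
    {K : Set V} {x : V} (hη : ∀ x ∈ K, η x = η' x)
    (hτ : ∀ p : V × ℕ, p.1 ∈ K → τ p = τ' p) (h : Visited η τ K x) : Visited η' τ' K x := by
  obtain ⟨l, hl, hx⟩ := h
  obtain ⟨h1, h2⟩ := run_initStage_congr (R := .keepOne K x) (l := l) hη
    fun p hp => hτ p (mem_of_mem_usedIndices hl hp)
  exact ⟨l, h2.1 hl, h1 ▸ hx⟩

lemma measurableSet_instruction_eq (q : V × ℕ) (i : Instruction V) :
    MeasurableSet {p : (V → Bool) × (V × ℕ → Instruction V) | p.2 q = i} :=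
  measurableSet_preimage (f := fun p : (V → Bool) × (V × ℕ → Instruction V) => p.2 q)
    (by fun_prop) (MeasurableSet.singleton i)

lemma measurableSet_particle (x : V) :
    MeasurableSet {p : (V → Bool) × (V × ℕ → Instruction V) | p.1 x = true} :=
  measurableSet_preimage (f := fun p : (V → Bool) × (V × ℕ → Instruction V) => p.1 x)
    (by fun_prop) (MeasurableSet.singleton true)

variable [Countable V]

lemma measurableSet_isLegal (R : ToppleRule V) (K : Finset V) (l : List V) :
    MeasurableSet {p : (V → Bool) × (V × ℕ → Instruction V) |
      IsLegal R p.2 (initStage p.1 K) l} :=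
  measurableSet_of_finite_dependence K (usedIndices l) fun _ _ _ _ h1 h2 h =>
    (run_initStage_congr h1 h2).2.1 h

lemma measurableSet_visited (K : Finset V) (x : V) :
    MeasurableSet {p : (V → Bool) × (V × ℕ → Instruction V) | Visited p.1 p.2 K x} := by
  have : {p : (V → Bool) × (V × ℕ → Instruction V) | Visited p.1 p.2 K x} =
      ⋃ l : List V, {p | IsLegal (.keepOne K x) p.2 (initStage p.1 K) l ∧
        0 < ((run p.2 (initStage p.1 K) l).1 x).numActive} := by
    ext p
    simp [Visited]
  rw [this]
  refine MeasurableSet.iUnion fun l =>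
    measurableSet_of_finite_dependence K (usedIndices l) fun η η' τ τ' h1 h2 h => ?_
  obtain ⟨h3, h4⟩ := run_initStage_congr (R := .keepOne K x) h1 h2
  exact ⟨h4.1 h.1, h3 ▸ h.2⟩

lemma measurableSet_keepsOne (K : Finset V) (x : V) (j : ℕ) :
    MeasurableSet {p : (V → Bool) × (V × ℕ → Instruction V) |
      ∃ l, KeepsOne p.1 p.2 K x l ∧ l.count x = j} := by
  have : {p : (V → Bool) × (V × ℕ → Instruction V) |
      ∃ l, KeepsOne p.1 p.2 K x l ∧ l.count x = j} =
      ⋃ l : List V, {p | KeepsOne p.1 p.2 K x l ∧ l.count x = j} := by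
    ext p
    simp
  rw [this]
  exact MeasurableSet.iUnion fun l =>
    measurableSet_of_finite_dependence K (usedIndices l) fun η η' τ τ' h1 h2 h =>
      ⟨h.1.congr h1 h2, h.2⟩

variable {G : SimpleGraph V} [G.LocallyFinite] (lam : ℝ≥0) (μ : I)

lemma ae_recurrent_stackLaw (hdeg : ∀ x, 0 < G.degree x) :
    ∀ᵐ p ∂(stackLaw G lam μ), Recurrent G p.2 := by
  have h1 : ∀ p : V × ℕ, IsProbabilityMeasure (instructionLaw G lam p.1) :=
    fun p => isProbabilityMeasure_instructionLaw G lam p.1 (hdeg p.1)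
  exact Measure.quasiMeasurePreserving_snd.ae (ae_recurrent G lam hdeg)

/-- Given that `x` is visited, the particle kept there falls asleep at once with the probability
that an instruction is a sleep instruction, even conditionally on an event `B` that does not
depend on the instructions at `x`. -/
lemma stackLaw_visited_mul_le [Infinite V] (hG : G.Connected) (hdeg : ∀ x, 0 < G.degree x)
    (K : Finset V) (x : V) {B : Set ((V → Bool) × (V × ℕ → Instruction V))} (hB : MeasurableSet B)
    (hinv : ∀ η τ τ', (∀ p : V × ℕ, p.1 ≠ x → τ p = τ' p) → (η, τ) ∈ B → (η, τ') ∈ B) :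
    stackLaw G lam μ (B ∩ {p | Visited p.1 p.2 K x}) * ((lam / (1 + lam) : ℝ≥0) : ℝ≥0∞) ≤
      stackLaw G lam μ
        (B ∩ {p | ∃ l, KeepsOne p.1 p.2 K x l ∧ p.2 (x, l.count x) = .sleep}) := by
  -- Split by the number `j` of instructions read at `x`: the event `D j` does not look at
  -- instruction `j` of `x`, hence is independent of it.
  set D : ℕ → Set ((V → Bool) × (V × ℕ → Instruction V)) :=
    fun j => {p | ∃ l, KeepsOne p.1 p.2 K x l ∧ l.count x = j} with hD
  have hDm : ∀ j, MeasurableSet (D j) := measurableSet_keepsOne K x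
  have hsm : ∀ j, MeasurableSet {p : (V → Bool) × (V × ℕ → Instruction V) |
      p.2 (x, j) = .sleep} := fun j =>
    measurableSet_instruction_eq (x, j) _
  have hdisj : Pairwise (Function.onFun Disjoint D) := by
    intro i j hij
    refine Set.disjoint_left.2 ?_
    rintro p ⟨l, hl, rfl⟩ ⟨l', hl', rfl⟩
    exact hij (hl.count_eq hl' x)
  have hvis : stackLaw G lam μ (B ∩ {p | Visited p.1 p.2 K x}) ≤
      stackLaw G lam μ (⋃ j, B ∩ D j) := by
    refine measure_mono_ae ?_
    filter_upwards [ae_recurrent_stackLaw lam μ hdeg] with p hp hv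
    obtain ⟨l, hl⟩ := Visited.exists_keepsOne hG hp hv.2
    exact Set.mem_iUnion.2 ⟨l.count x, hv.1, l, hl, rfl⟩
  have hindep : ∀ j, stackLaw G lam μ (B ∩ D j) * ((lam / (1 + lam) : ℝ≥0) : ℝ≥0∞) =
      stackLaw G lam μ (B ∩ D j ∩ {p | p.2 (x, j) = .sleep}) := by
    intro j
    rw [stackLaw_inter_sleep G lam μ hdeg x j (hB.inter (hDm j))]
    rintro η τ τ' hτ ⟨hb, l, hl, hlj⟩
    refine ⟨hinv η τ τ' (fun p hp => hτ p fun h => hp (by rw [h])) hb, l,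
      hl.congr (fun _ _ => rfl) (fun p hp => hτ p ?_), hlj⟩
    rintro rfl
    exact absurd (mem_usedIndices.1 hp) (by simp [hlj])
  calc _ ≤ stackLaw G lam μ (⋃ j, B ∩ D j) * ((lam / (1 + lam) : ℝ≥0) : ℝ≥0∞) := by
        gcongr
    _ = ∑' j, stackLaw G lam μ (B ∩ D j ∩ {p | p.2 (x, j) = .sleep}) := by
        rw [measure_iUnion _ fun j => hB.inter (hDm j), ← ENNReal.tsum_mul_right]
        · exact tsum_congr hindep
        · exact fun i j hij => (hdisj hij).mono Set.inter_subset_right Set.inter_subset_right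
    _ = stackLaw G lam μ (⋃ j, B ∩ D j ∩ {p | p.2 (x, j) = .sleep}) := by
        rw [measure_iUnion _ fun j => (hB.inter (hDm j)).inter (hsm j)]
        exact fun i j hij => (hdisj hij).mono
          (Set.inter_subset_left.trans Set.inter_subset_right)
          (Set.inter_subset_left.trans Set.inter_subset_right)
    _ ≤ _ := by
        refine measure_mono fun p hp => ?_
        obtain ⟨j, ⟨hb, l, hl, rfl⟩, hs⟩ := Set.mem_iUnion.1 hp
        exact ⟨hb, l, hl, hs⟩

/-- The expected numbers of visited vertices and of particles in `K`, on an event `B` that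
depends only on what happens in `K₁`. -/
lemma sum_visited_mul_le [Infinite V] (hG : G.Connected) (hdeg : ∀ x, 0 < G.degree x)
    (K K₁ : Finset V)
    {B : Set ((V → Bool) × (V × ℕ → Instruction V))} (hB : MeasurableSet B)
    (hinv : ∀ η η' τ τ', (∀ x ∈ K₁, η x = η' x) → (∀ p : V × ℕ, p.1 ∈ K₁ → τ p = τ' p) →
      (η, τ) ∈ B → (η', τ') ∈ B) :
    (∑ x ∈ K \ K₁, stackLaw G lam μ (B ∩ {p | Visited p.1 p.2 K x})) *
        ((lam / (1 + lam) : ℝ≥0) : ℝ≥0∞) ≤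
      K₁.card + K.card * (stackLaw G lam μ B * ENNReal.ofReal μ) := by
  have hprob := isProbabilityMeasure_stackLaw G lam μ hdeg
  set P := stackLaw G lam μ with hP
  -- The random index `l.count x` is unfolded into a union over `j`, which makes measurability
  -- visible.
  set S : V → Set ((V → Bool) × (V × ℕ → Instruction V)) := fun x =>
    B ∩ ⋃ j, ({p | ∃ l, KeepsOne p.1 p.2 K x l ∧ l.count x = j} ∩ {p | p.2 (x, j) = .sleep})
    with hS
  have hSm : ∀ x, MeasurableSet (S x) := fun x =>
    hB.inter (MeasurableSet.iUnion fun j => (measurableSet_keepsOne K x j).inter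
      (measurableSet_instruction_eq (x, j) _))
  have hSeq : ∀ x, S x = B ∩ {p | ∃ l, KeepsOne p.1 p.2 K x l ∧ p.2 (x, l.count x) = .sleep} := by
    intro x
    ext p
    simp only [hS, Set.mem_inter_iff, Set.mem_iUnion, Set.mem_ofPred_eq]
    refine and_congr_right fun _ => ⟨?_, ?_⟩
    · rintro ⟨j, ⟨l, hl, rfl⟩, hs⟩
      exact ⟨l, hl, hs⟩
    · rintro ⟨l, hl, hs⟩
      exact ⟨_, ⟨l, hl, rfl⟩, hs⟩
  set T : V → Set ((V → Bool) × (V × ℕ → Instruction V)) := fun y => B ∩ {p | p.1 y = true}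
    with hT
  have hTm : ∀ y, MeasurableSet (T y) := fun y =>
    hB.inter (measurableSet_particle y)
  have hpt : ∀ p, ∑ x ∈ K \ K₁, (S x).indicator (fun _ => (1 : ℝ≥0∞)) p ≤
      ∑ y ∈ K, (T y).indicator (fun _ => (1 : ℝ≥0∞)) p := by
    intro p
    by_cases hp : p ∈ B
    · have h1 := card_sleepers_le (η := p.1) (τ := p.2) (K := K)
        (X := (K \ K₁).filter fun x => p ∈ S x)
        ((Finset.filter_subset _ _).trans Finset.sdiff_subset) fun x hx => by
          have := (Finset.mem_filter.1 hx).2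
          rw [hSeq] at this
          exact this.2
      simp only [Set.indicator_apply]
      rw [Finset.sum_boole, Finset.sum_boole]
      simp only [hT, Set.mem_inter_iff, hp, true_and, Set.mem_ofPred_eq]
      exact_mod_cast h1
    · rw [Finset.sum_eq_zero fun x _ => Set.indicator_of_notMem (fun h => hp h.1) _]
      exact zero_le
  have hint := lintegral_mono (μ := P) hpt
  rw [lintegral_finsetSum _ fun x _ => measurable_const.indicator (hSm x),
    lintegral_finsetSum _ fun x _ => measurable_const.indicator (hTm x)] at hint
  simp only [lintegral_indicator_const (hSm _), lintegral_indicator_const (hTm _), one_mul] at hint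
  calc _ ≤ ∑ x ∈ K \ K₁, P (S x) := by
        rw [Finset.sum_mul]
        refine Finset.sum_le_sum fun x hx => ?_
        rw [hSeq]
        refine stackLaw_visited_mul_le lam μ hG hdeg K x hB fun η τ τ' hτ =>
          hinv η η τ τ' (fun _ _ => rfl) fun p hp => hτ p ?_
        rintro rfl
        exact (Finset.mem_sdiff.1 hx).2 hp
    _ ≤ ∑ y ∈ K, P (T y) := hint
    -- Outside `K₁` the initial particle is independent of `B`; the vertices of `K₁` are bounded
    -- trivially by 1.
    _ ≤ ∑ y ∈ K, ((if y ∈ K₁ then 1 else 0) + P B * ENNReal.ofReal μ) := by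
        refine Finset.sum_le_sum fun y _ => ?_
        by_cases hy : y ∈ K₁
        · rw [if_pos hy]
          exact prob_le_one.trans le_self_add
        · rw [if_neg hy, zero_add, hT]
          refine (stackLaw_inter_particle G lam μ hdeg y hB fun τ η η' hη =>
            hinv η η' τ τ (fun x hx => hη x ?_) fun _ _ => rfl).le
          rintro rfl
          exact hy hx
    _ ≤ _ := by
        rw [Finset.sum_add_distrib, Finset.sum_const, nsmul_eq_mul]
        gcongr
        rw [Finset.sum_boole]
        exact_mod_cast Finset.card_le_card fun y hy => (Finset.mem_filter.1 hy).2

end Events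

/-! ### Balls and boundaries -/

section Geometry

variable {V : Type*} {G : SimpleGraph V}

/-- The vertices that can be reached from `x` in at most `r` steps. -/
def walkBall (G : SimpleGraph V) (x : V) (r : ℕ) : Set V :=
  {z | ∃ p : G.Walk x z, p.length ≤ r}

lemma walkBall_map (φ : G ≃g G) (x : V) (r : ℕ) : walkBall G (φ x) r = φ '' walkBall G x r := by
  ext z
  constructor
  · rintro ⟨p, hp⟩
    refine ⟨φ.symm z, ⟨(p.map φ.symm.toHom).copy (φ.symm_apply_apply x) rfl, ?_⟩,
      φ.apply_symm_apply z⟩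
    simpa using hp
  · rintro ⟨w, ⟨p, hp⟩, rfl⟩
    exact ⟨p.map φ.toHom, by simpa using hp⟩

lemma finite_walkBall [G.LocallyFinite] (x : V) (r : ℕ) : (walkBall G x r).Finite := by
  induction r generalizing x with
  | zero =>
    refine (Set.finite_singleton x).subset ?_
    rintro z ⟨p, hp⟩
    exact (SimpleGraph.Walk.eq_of_length_eq_zero (Nat.le_zero.1 hp)).symm
  | succ r ih =>
    refine ((Set.finite_singleton x).union ((Set.toFinite (G.neighborSet x)).biUnion
      fun y _ => ih y)).subset ?_
    rintro z ⟨p, hp⟩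
    cases p with
    | nil => exact Or.inl rfl
    | @cons _ y _ h q =>
      refine Or.inr (Set.mem_biUnion (x := y) h ⟨q, ?_⟩)
      rw [SimpleGraph.Walk.length_cons] at hp
      omega

lemma countable_of_connected [G.LocallyFinite] (hG : G.Connected) : Countable V := by
  obtain ⟨o⟩ := hG.nonempty
  have : (Set.univ : Set V) = ⋃ r, walkBall G o r := by
    refine (Set.eq_univ_of_forall fun z => ?_).symm
    obtain ⟨p⟩ := hG.preconnected o z
    exact Set.mem_iUnion.2 ⟨p.length, p, le_rfl⟩
  rw [← Set.countable_univ_iff, this]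
  exact Set.countable_iUnion fun r => (finite_walkBall o r).countable

lemma ncard_walkBall (htrans : VertexTransitive G) (x y : V) (r : ℕ) :
    (walkBall G x r).ncard = (walkBall G y r).ncard := by
  obtain ⟨φ, rfl⟩ := htrans x y
  rw [walkBall_map, Set.ncard_image_of_injective _ φ.injective]

/-- A walk that leaves a set crosses its boundary. -/
lemma exists_mem_extBoundary {K : Set V} {x z : V} (p : G.Walk x z) (hx : x ∈ K) (hz : z ∉ K) :
    ∃ v ∈ extBoundary G K, ∃ q : G.Walk x v, q.length ≤ p.length := by
  induction p with
  | nil => exact absurd hx hz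
  | @cons x y z h p ih =>
    by_cases hy : y ∈ K
    · obtain ⟨v, hv, q, hq⟩ := ih hy hz
      exact ⟨v, hv, .cons h q, by simpa using hq⟩
    · exact ⟨y, ⟨hy, x, hx, h⟩, .cons h .nil, by simp⟩

lemma finite_extBoundary [G.LocallyFinite] (K : Finset V) : (extBoundary G (K : Set V)).Finite := by
  refine (K.finite_toSet.biUnion fun u _ => Set.toFinite (G.neighborSet u)).subset ?_
  rintro v ⟨-, u, hu, huv⟩
  exact Set.mem_biUnion hu huv

/-- Lets a constant be absorbed into a multiple of the boundary, so that amenability alone makes the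
set large compared with `K₁`. -/
lemma one_le_ncard_extBoundary [Infinite V] [G.LocallyFinite] (hG : G.Connected) {K : Finset V}
    (hK : K.Nonempty) : 1 ≤ (extBoundary G (K : Set V)).ncard := by
  obtain ⟨x, hx⟩ := hK
  obtain ⟨z, hz⟩ := Infinite.exists_notMem_finset K
  obtain ⟨p⟩ := hG.preconnected x z
  obtain ⟨v, hv, -⟩ := exists_mem_extBoundary (K := (K : Set V)) p hx hz
  exact (Set.ncard_pos (finite_extBoundary K)).2 ⟨v, hv⟩

/-- Few vertices of a set with a small boundary are close to its complement. -/
lemma card_shallow_le [G.LocallyFinite] (htrans : VertexTransitive G) (o : V) (r : ℕ)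
    (K : Finset V) :
    (K.filter fun x => ¬ walkBall G x r ⊆ (K : Set V)).card ≤
      (extBoundary G (K : Set V)).ncard * (walkBall G o r).ncard := by
  have hfin := finite_extBoundary (G := G) K
  have hsub : (K.filter fun x => ¬ walkBall G x r ⊆ (K : Set V)) ⊆
      hfin.toFinset.biUnion fun v => (finite_walkBall (G := G) v r).toFinset := by
    intro x hx
    rw [Finset.mem_filter, Set.not_subset] at hx
    obtain ⟨hxK, z, ⟨p, hp⟩, hz⟩ := hx
    obtain ⟨v, hv, q, hq⟩ := exists_mem_extBoundary p (by exact hxK) hz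
    rw [Finset.mem_biUnion]
    refine ⟨v, hfin.mem_toFinset.2 hv, (Set.Finite.mem_toFinset _).2 ⟨q.reverse, ?_⟩⟩
    rw [SimpleGraph.Walk.length_reverse]
    exact hq.trans hp
  refine (Finset.card_le_card hsub).trans ?_
  rw [Set.ncard_eq_toFinset_card _ hfin]
  refine Finset.card_biUnion_le_card_mul _ _ _ fun v _ => ?_
  rw [← Set.ncard_eq_toFinset_card _ (finite_walkBall v r), ncard_walkBall htrans v o]

end Geometry

/-! ### The density bound -/

section Density

variable {V : Type*} {G : SimpleGraph V} [G.LocallyFinite] (lam : ℝ≥0) (μ : I)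

/-- Every vertex is visited, starting from the particles in some finite set. -/
def allVisited (V : Type*) : Set ((V → Bool) × (V × ℕ → Instruction V)) :=
  {p | ∀ x, ∃ K : Finset V, Visited p.1 p.2 K x}

variable [Countable V]

lemma measurableSet_exists_visited (x : V) :
    MeasurableSet {p : (V → Bool) × (V × ℕ → Instruction V) |
      ∃ K : Finset V, Visited p.1 p.2 K x} := by
  have : {p : (V → Bool) × (V × ℕ → Instruction V) | ∃ K : Finset V, Visited p.1 p.2 K x} =
      ⋃ K : Finset V, {p | Visited p.1 p.2 K x} := by
    ext p; simp
  rw [this]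
  exact MeasurableSet.iUnion fun K => measurableSet_visited K x

/-- By transitivity, a ball of suitable radius decides at every vertex, up to a small probability,
whether it is ever visited. -/
lemma exists_radius (hG : G.Connected) (hdeg : ∀ x, 0 < G.degree x) (htrans : VertexTransitive G)
    {ε : ℝ} (hε : 0 < ε) :
    ∃ r, ∀ x, ∀ K : Finset V, walkBall G x r ⊆ (K : Set V) →
      (stackLaw G lam μ).real ({p | ∃ K : Finset V, Visited p.1 p.2 K x} \
        {p | Visited p.1 p.2 K x}) ≤ ε := by
  have hprob := isProbabilityMeasure_stackLaw G lam μ hdeg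
  obtain ⟨o⟩ := hG.nonempty
  obtain ⟨K₀, hK₀⟩ : ∃ K₀ : Finset V,
      (stackLaw G lam μ).real ({p | ∃ K : Finset V, Visited p.1 p.2 K o} \
        {p | Visited p.1 p.2 K₀ o}) ≤ ε := by
    have hanti : Antitone fun K₀ : Finset V =>
        {p : (V → Bool) × (V × ℕ → Instruction V) | ∃ K : Finset V, Visited p.1 p.2 K o} \
          {p | Visited p.1 p.2 K₀ o} := fun K K' h =>
      Set.sdiff_subset_sdiff_right fun p hp => Visited.mono (by exact_mod_cast h) hp
    have hlim := tendsto_measure_iInter_atTop (μ := stackLaw G lam μ)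
      (fun K₀ => ((measurableSet_exists_visited o).diff
        (measurableSet_visited K₀ o)).nullMeasurableSet) hanti ⟨∅, measure_ne_top _ _⟩
    have hempty : (⋂ K₀ : Finset V,
        {p : (V → Bool) × (V × ℕ → Instruction V) | ∃ K : Finset V, Visited p.1 p.2 K o} \
          {p | Visited p.1 p.2 K₀ o}) = ∅ := by
      refine Set.eq_empty_of_forall_notMem fun p hp => ?_
      obtain ⟨K, hK⟩ := (Set.mem_iInter.1 hp ∅).1
      exact (Set.mem_iInter.1 hp K).2 hK
    rw [hempty, measure_empty] at hlim
    obtain ⟨K₀, hK₀⟩ := (hlim.eventually_le_const (ENNReal.ofReal_pos.2 hε)).exists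
    exact ⟨K₀, ENNReal.toReal_le_of_le_ofReal hε.le hK₀⟩
  have hwalk : ∀ z, ∃ p : G.Walk o z, True := fun z =>
    let ⟨p⟩ := hG.preconnected o z; ⟨p, trivial⟩
  choose w _ using hwalk
  -- A radius for which the ball around `o` contains `K₀`; automorphisms carry this inclusion to
  -- every other vertex.
  refine ⟨K₀.sup fun z => (w z).length, fun x K hK => ?_⟩
  obtain ⟨φ, rfl⟩ := htrans o x
  have hsub : φ '' (K₀ : Set V) ⊆ K := by
    rintro _ ⟨z, hz, rfl⟩
    refine hK ⟨(w z).map φ.toHom, ?_⟩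
    rw [SimpleGraph.Walk.length_map]
    exact Finset.le_sup (f := fun z => (w z).length) hz
  refine le_trans ?_ hK₀
  have hmp := measurePreserving_relabel G lam μ hdeg φ
  rw [Measure.real, Measure.real, ← hmp.measure_preimage
    ((measurableSet_exists_visited _).diff (measurableSet_visited _ _)).nullMeasurableSet]
  refine ENNReal.toReal_mono (measure_ne_top _ _) (measure_mono ?_)
  rintro p ⟨⟨K', hK'⟩, hp⟩
  refine ⟨⟨K'.map φ.symm.toEquiv.toEmbedding, ?_⟩, fun hv => hp ?_⟩
  · rw [← visited_relabel φ.toEquiv]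
    have : φ.toEquiv '' ((K'.map φ.symm.toEquiv.toEmbedding : Finset V) : Set V) = K' := by
      ext z
      simp [Set.mem_image]
    rw [this]
    exact hK'
  · exact ((visited_relabel φ.toEquiv _ _).2 hv).mono hsub

/-- The event that every vertex is visited is approximated by an event that depends only on what
happens in a finite set. -/
lemma exists_approximation (hdeg : ∀ x, 0 < G.degree x) {ε : ℝ} (hε : 0 < ε) :
    ∃ (K₁ : Finset V) (B : Set ((V → Bool) × (V × ℕ → Instruction V))), MeasurableSet B ∧
      (∀ η η' τ τ', (∀ x ∈ K₁, η x = η' x) → (∀ p : V × ℕ, p.1 ∈ K₁ → τ p = τ' p) →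
        (η, τ) ∈ B → (η', τ') ∈ B) ∧
      (stackLaw G lam μ).real (allVisited V \ B) ≤ ε ∧
      (stackLaw G lam μ).real B ≤ (stackLaw G lam μ).real (allVisited V) + ε := by
  have hprob := isProbabilityMeasure_stackLaw G lam μ hdeg
  set P := stackLaw G lam μ with hP
  -- Two limits: finitely many vertices `X` replace all vertices, and then one finite set `K₁` in
  -- which all of `X` is visited replaces the union over finite sets.
  set A : Finset V → Set ((V → Bool) × (V × ℕ → Instruction V)) :=
    fun X => ⋂ x ∈ X, {p | ∃ K : Finset V, Visited p.1 p.2 K x} with hA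
  have hAm : ∀ X, MeasurableSet (A X) := fun X =>
    Finset.measurableSet_biInter X fun x _ => measurableSet_exists_visited x
  have hAanti : Antitone A := fun X Y h => Set.biInter_subset_biInter_left h
  have hAall : (⋂ X, A X) = allVisited V := by
    ext p
    simp only [hA, Set.mem_iInter, allVisited, Set.mem_ofPred_eq]
    exact ⟨fun h x => h {x} x (Finset.mem_singleton_self x), fun h _ x _ => h x⟩
  have hlim := tendsto_measure_iInter_atTop (μ := P) (fun X => (hAm X).nullMeasurableSet) hAanti
    ⟨∅, measure_ne_top _ _⟩
  rw [hAall] at hlim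
  have hlim' : Tendsto (fun X => P.real (A X)) atTop (nhds (P.real (allVisited V))) :=
    (ENNReal.tendsto_toReal (measure_ne_top _ _)).comp hlim
  obtain ⟨X, hX⟩ := (hlim'.eventually_le_const (lt_add_of_pos_right _ hε)).exists
  set B : Finset V → Set ((V → Bool) × (V × ℕ → Instruction V)) :=
    fun K => ⋂ x ∈ X, {p | Visited p.1 p.2 K x} with hB
  have hBm : ∀ K, MeasurableSet (B K) := fun K =>
    Finset.measurableSet_biInter X fun x _ => measurableSet_visited K x
  have hBmono : Monotone B := fun K K' h => Set.iInter₂_mono fun x _ p hp =>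
    Visited.mono (by exact_mod_cast h) hp
  have hanti : Antitone fun K => A X \ B K := fun K K' h =>
    Set.sdiff_subset_sdiff_right (hBmono h)
  have hempty : (⋂ K, A X \ B K) = ∅ := by
    refine Set.eq_empty_of_forall_notMem fun p hp => ?_
    have hp1 := fun x (hx : x ∈ X) => Set.mem_iInter₂.1 (Set.mem_iInter.1 hp ∅).1 x hx
    choose! f hf using hp1
    refine (Set.mem_iInter.1 hp (X.biUnion f)).2 (Set.mem_iInter₂.2 fun x hx => ?_)
    exact Visited.mono (by exact_mod_cast Finset.subset_biUnion_of_mem f hx) (hf x hx)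
  have hlim2 := tendsto_measure_iInter_atTop (μ := P)
    (fun K => ((hAm X).diff (hBm K)).nullMeasurableSet) hanti ⟨∅, measure_ne_top _ _⟩
  rw [hempty, measure_empty] at hlim2
  obtain ⟨K₁, hK₁⟩ := (hlim2.eventually_le_const (ENNReal.ofReal_pos.2 hε)).exists
  refine ⟨K₁, B K₁, hBm K₁, ?_, ?_, ?_⟩
  · intro η η' τ τ' hη hτ h
    exact Set.mem_iInter₂.2 fun x hx => Visited.congr hη hτ (Set.mem_iInter₂.1 h x hx)
  · refine ENNReal.toReal_le_of_le_ofReal hε.le ((measure_mono ?_).trans hK₁)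
    refine Set.sdiff_subset_sdiff_left ?_
    rw [← hAall]
    exact Set.iInter_subset _ X
  · refine (measureReal_mono ?_).trans hX
    exact Set.iInter₂_mono fun x _ p hp => ⟨K₁, hp⟩

/-- The factor `1 - ε` is the proportion of deep vertices of `K` outside `K₁`. One `ε` in `a - 2 *
ε` pays for replacing the full event by `B`, the other for visits that need particles or topplings
outside `K`. -/
lemma density_estimate [Infinite V] (hG : G.Connected) (hdeg : ∀ x, 0 < G.degree x)
    (htrans : VertexTransitive G) (hamen : Amenable G) {ε : ℝ} (hε : 0 < ε)
    (hε' : 2 * ε ≤ (stackLaw G lam μ).real (allVisited V)) :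
    (1 - ε) * ((stackLaw G lam μ).real (allVisited V) - 2 * ε) * ((lam : ℝ) / (1 + lam)) ≤
      ε + ((stackLaw G lam μ).real (allVisited V) + ε) * μ := by
  have hprob := isProbabilityMeasure_stackLaw G lam μ hdeg
  obtain ⟨o⟩ := hG.nonempty
  obtain ⟨r, hr⟩ := exists_radius lam μ hG hdeg htrans hε
  obtain ⟨K₁, B, hBm, hBinv, hB1, hB2⟩ := exists_approximation lam μ hdeg hε
  set P := stackLaw G lam μ with hP
  set a := P.real (allVisited V) with ha
  set C : ℕ := K₁.card + (walkBall G o r).ncard with hC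
  -- `C` covers both discarded sets: `K₁`, and the vertices near the boundary, at most one ball per
  -- boundary vertex. The `+ 1` keeps the denominator positive.
  obtain ⟨K, hKne, hK⟩ := hamen (ε / (C + 1)) (by positivity)
  have hKpos : (0 : ℝ) < K.card := by exact_mod_cast hKne.card_pos
  have hbd : (1 : ℝ) ≤ (extBoundary G (K : Set V)).ncard := by
    exact_mod_cast one_le_ncard_extBoundary hG hKne
  have hCK : (C : ℝ) * (extBoundary G (K : Set V)).ncard ≤ ε * K.card := by
    calc (C : ℝ) * (extBoundary G (K : Set V)).ncard
        ≤ (C + 1) * (ε / (C + 1) * K.card) := by gcongr; linarith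
      _ = ε * K.card := by field_simp
  set Dp := (K \ K₁).filter fun x => walkBall G x r ⊆ (K : Set V) with hDp
  have hcard : (1 - ε) * K.card ≤ (Dp.card : ℝ) := by
    have h1 : K.card ≤ Dp.card + (K₁.card +
        (K.filter fun x => ¬ walkBall G x r ⊆ (K : Set V)).card) := by
      have : K ⊆ Dp ∪ (K₁ ∪ K.filter fun x => ¬ walkBall G x r ⊆ (K : Set V)) := by
        intro x hx
        simp only [hDp, Finset.mem_union, Finset.mem_filter, Finset.mem_sdiff]
        tauto
      exact (Finset.card_le_card this).trans ((Finset.card_union_le _ _).trans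
        (Nat.add_le_add_left (Finset.card_union_le _ _) _))
    have h2 := card_shallow_le (G := G) htrans o r K
    have h3 : (K.card : ℝ) ≤ Dp.card + (K₁.card +
        (extBoundary G (K : Set V)).ncard * (walkBall G o r).ncard) := by
      exact_mod_cast h1.trans (by omega)
    have h4 : (K₁.card : ℝ) ≤ K₁.card * (extBoundary G (K : Set V)).ncard :=
      le_mul_of_one_le_right (Nat.cast_nonneg _) hbd
    rw [hC] at hCK
    push_cast at hCK
    nlinarith
  have hdeep : ∀ x ∈ Dp, a - 2 * ε ≤ P.real (B ∩ {p | Visited p.1 p.2 K x}) := by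
    intro x hx
    have hx' := hr x K (Finset.mem_filter.1 hx).2
    have hsub : allVisited V ⊆ (B ∩ {p | Visited p.1 p.2 K x}) ∪ ((allVisited V \ B) ∪
        ({p | ∃ K : Finset V, Visited p.1 p.2 K x} \ {p | Visited p.1 p.2 K x})) := by
      intro p hp
      by_cases h1 : p ∈ B
      · by_cases h2 : Visited p.1 p.2 K x
        · exact Or.inl ⟨h1, h2⟩
        · exact Or.inr (Or.inr ⟨hp x, h2⟩)
      · exact Or.inr (Or.inl ⟨hp, h1⟩)
    have h3 := (measureReal_mono (μ := P) hsub).trans ((measureReal_union_le _ _).trans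
      (add_le_add_right (measureReal_union_le _ _) _))
    linarith
  have hmain := sum_visited_mul_le lam μ hG hdeg K K₁ hBm hBinv
  have hmain' : (∑ x ∈ K \ K₁, P.real (B ∩ {p | Visited p.1 p.2 K x})) *
      ((lam : ℝ) / (1 + lam)) ≤ K₁.card + K.card * (P.real B * μ) := by
    have h := ENNReal.toReal_mono (by finiteness) hmain
    rw [ENNReal.toReal_mul, ENNReal.toReal_sum fun _ _ => measure_ne_top _ _,
      ENNReal.toReal_add (by finiteness) (by finiteness), ENNReal.toReal_mul, ENNReal.toReal_mul,
      ENNReal.toReal_ofReal μ.2.1] at h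
    simp only [ENNReal.coe_toReal, ENNReal.toReal_natCast, NNReal.coe_div, NNReal.coe_add,
      NNReal.coe_one] at h
    exact h
  have hq : (0 : ℝ) ≤ (lam : ℝ) / (1 + lam) := by positivity
  have hlow : (1 - ε) * K.card * (a - 2 * ε) ≤
      ∑ x ∈ K \ K₁, P.real (B ∩ {p | Visited p.1 p.2 K x}) := by
    calc (1 - ε) * K.card * (a - 2 * ε) ≤ Dp.card * (a - 2 * ε) := by
          gcongr
      _ = ∑ x ∈ Dp, (a - 2 * ε) := by rw [Finset.sum_const, nsmul_eq_mul]
      _ ≤ ∑ x ∈ Dp, P.real (B ∩ {p | Visited p.1 p.2 K x}) := Finset.sum_le_sum hdeep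
      _ ≤ _ := Finset.sum_le_sum_of_subset_of_nonneg (Finset.filter_subset _ _)
          fun _ _ _ => measureReal_nonneg
  have hK1 : (K₁.card : ℝ) ≤ ε * K.card := by
    refine le_trans ?_ hCK
    have : (K₁.card : ℝ) ≤ C := by exact_mod_cast Nat.le_add_right _ _
    nlinarith [Nat.cast_nonneg (α := ℝ) C]
  have hμ0 : (0 : ℝ) ≤ μ := μ.2.1
  have hfin : ((1 - ε) * (a - 2 * ε) * ((lam : ℝ) / (1 + lam))) * K.card ≤
      (ε + (a + ε) * μ) * K.card := by
    calc _ = (1 - ε) * K.card * (a - 2 * ε) * ((lam : ℝ) / (1 + lam)) := by ring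
      _ ≤ _ := mul_le_mul_of_nonneg_right hlow hq
      _ ≤ _ := hmain'
      _ ≤ ε * K.card + K.card * ((a + ε) * μ) := by gcongr
      _ = _ := by ring
  exact le_of_mul_le_mul_right hfin hKpos

/-- Below the density `λ / (1 + λ)`, almost surely some vertex is never visited. -/
lemma measure_allVisited_eq_zero [Infinite V] (hG : G.Connected) (hdeg : ∀ x, 0 < G.degree x)
    (htrans : VertexTransitive G) (hamen : Amenable G)
    (hμ : (μ : ℝ) < (lam : ℝ) / (1 + lam)) : stackLaw G lam μ (allVisited V) = 0 := by
  have hprob := isProbabilityMeasure_stackLaw G lam μ hdeg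
  by_contra hne
  set a := (stackLaw G lam μ).real (allVisited V) with ha
  have hapos : 0 < a := ENNReal.toReal_pos hne (measure_ne_top _ _)
  have h1 : Tendsto (fun ε : ℝ => (1 - ε) * (a - 2 * ε) * ((lam : ℝ) / (1 + lam)))
      (nhdsWithin 0 (Set.Ioi 0)) (nhds ((1 - 0) * (a - 2 * 0) * ((lam : ℝ) / (1 + lam)))) := by
    refine Tendsto.mono_left (Continuous.tendsto ?_ 0) nhdsWithin_le_nhds
    fun_prop
  have h2 : Tendsto (fun ε : ℝ => ε + (a + ε) * (μ : ℝ))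
      (nhdsWithin 0 (Set.Ioi 0)) (nhds (0 + (a + 0) * (μ : ℝ))) := by
    refine Tendsto.mono_left (Continuous.tendsto ?_ 0) nhdsWithin_le_nhds
    fun_prop
  -- As `ε` tends to 0 the estimate becomes a q ≤ a μ, which contradicts `hμ` when `a` is positive.
  have h3 := le_of_tendsto_of_tendsto h1 h2 (by
    filter_upwards [Ioo_mem_nhdsGT (show (0 : ℝ) < a / 2 by positivity)] with ε hε
    exact density_estimate lam μ hG hdeg htrans hamen hε.1 (by linarith [hε.2]))
  have h4 := mul_lt_mul_of_pos_left hμ hapos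
  linarith

end Density

/-! ### The continuous-time process as a legal sequence of topplings -/

section Dynamics

variable {V : Type*} {lam : ℝ≥0} {ω : Sample V} {Λ : Finset V}

lemma IsLegal.sum_count_le_card {R : ToppleRule V} {η : V → Bool} {τ : V × ℕ → Instruction V}
    {l : List V} (hl : IsLegal R τ (initStage η Λ) l) (F : Finset V) :
    ∑ z ∈ F, ((run τ (initStage η Λ) l).1 z).count ≤ Λ.card := by
  calc _ ≤ ∑ z ∈ F ∪ l.toFinset, ((run τ (initStage η Λ) l).1 z).count :=
        Finset.sum_le_sum_of_subset Finset.subset_union_left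
    _ ≤ ∑ z ∈ F ∪ l.toFinset, ((initStage η (Λ : Set V)).1 z).count :=
        hl.sum_count_run_le _ fun v hv => by simp [hv]
    _ = ((F ∪ l.toFinset).filter fun z => z ∈ (Λ : Set V) ∧ η z = true).card := by
        rw [Finset.card_filter]
        exact Finset.sum_congr rfl fun z _ => by rw [count_initStage]; congr
    _ ≤ Λ.card := Finset.card_le_card fun z hz => (Finset.mem_filter.1 hz).2.1

lemma IsLegal.sum_numActive_le_card {R : ToppleRule V} {η : V → Bool} {τ : V × ℕ → Instruction V}
    {l : List V} (hl : IsLegal R τ (initStage η Λ) l) (F : Finset V) :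
    ∑ z ∈ F, ((run τ (initStage η Λ) l).1 z).numActive ≤ Λ.card :=
  (Finset.sum_le_sum fun _ _ => SiteState.numActive_le_count _).trans (hl.sum_count_le_card F)

lemma IsLegal.finite_active {R : ToppleRule V} {η : V → Bool} {τ : V × ℕ → Instruction V}
    {l : List V} (hl : IsLegal R τ (initStage η Λ) l) :
    {z | 0 < ((run τ (initStage η Λ) l).1 z).numActive}.Finite := by
  by_contra hinf
  obtain ⟨F, hF, hcard⟩ := Set.Infinite.exists_subset_card_eq hinf (Λ.card + 1)
  have h1 := hl.sum_numActive_le_card F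
  have h2 : F.card ≤ ∑ z ∈ F, ((run τ (initStage η Λ) l).1 z).numActive := by
    rw [Finset.card_eq_sum_ones]
    exact Finset.sum_le_sum fun z hz => hF hz
  omega

/-- The total waiting time of the instructions used by a list of topplings. -/
def totalWait (w : V × ℕ → ℝ) (l : List V) : ℝ := ∑ p ∈ usedIndices l, w p

lemma totalWait_eq (w : V × ℕ → ℝ) (l : List V) :
    totalWait w l = ∑ y ∈ l.toFinset, ∑ i ∈ Finset.range (l.count y), w (y, i) := by
  rw [totalWait, usedIndices, Finset.sum_biUnion]
  · exact Finset.sum_congr rfl fun y _ => Finset.sum_map _ _ _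
  · intro y _ z _ hyz
    rw [Function.onFun, Finset.disjoint_left]
    intro p hp hp'
    simp only [Finset.mem_map] at hp hp'
    obtain ⟨i, -, rfl⟩ := hp
    obtain ⟨j, -, h⟩ := hp'
    exact hyz (congrArg Prod.fst h).symm

/-- The long legal sequences of topplings take a long time. -/
def WaitsDiverge (ω : Sample V) : Prop :=
  ∀ (Λ : Finset V) (c : ℝ), ∃ n, ∀ l, IsLegal (.on Set.univ) ω.2.1 (initStage ω.1 Λ) l →
    l.length = n → c < totalWait ω.2.2 l

/-- The state `s` is obtained, from the particles in `Λ`, by the topplings of `l`, and its clocks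
agree with the number of past rings. -/
structure IsHistory (lam : ℝ≥0) (ω : Sample V) (Λ : Finset V) (s : State V) (l : List V) :
    Prop where
  legal : IsLegal (.on Set.univ) ω.2.1 (initStage ω.1 Λ) l
  run_eq : run ω.2.1 (initStage ω.1 Λ) l = (s.config, s.rings)
  le_clock : ∀ y, ∑ i ∈ Finset.range (s.rings y), ω.2.2 (y, i) ≤ s.clock y
  clock_le : ∀ y, s.clock y ≤ ringTime ω y (s.rings y)
  sum_clock_le : ∀ F : Finset V, ∑ y ∈ F, s.clock y ≤ (1 + lam) * Λ.card * s.time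

variable {s : State V} {l : List V}

lemma IsHistory.config_eq (h : IsHistory lam ω Λ s l) :
    (run ω.2.1 (initStage ω.1 Λ) l).1 = s.config := by rw [h.run_eq]

lemma IsHistory.rings_eq (h : IsHistory lam ω Λ s l) (x : V) : s.rings x = l.count x := by
  rw [← run_initStage_snd (τ := ω.2.1) (η := ω.1) (Λ : Set V) l x, h.run_eq]

lemma isHistory_initialState (hω : ∀ p, 0 ≤ ω.2.2 p) :
    IsHistory lam ω Λ (initialState ω Λ) [] where
  legal := trivial
  run_eq := by simp [run, initStage, initialState]
  le_clock y := by simp [initialState]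
  clock_le y := Finset.sum_nonneg fun _ _ => hω _
  sum_clock_le F := by simp [initialState]

lemma speed_pos {x : V} (hx : 0 < (s.config x).numActive) : 0 < s.speed lam x := by
  have : (0 : ℝ) < (s.config x).numActive := by exact_mod_cast hx
  have h : (0 : ℝ) ≤ lam := lam.2
  exact mul_pos (by linarith) this

lemma speed_nonneg (x : V) : 0 ≤ s.speed lam x := by
  have h : (0 : ℝ) ≤ lam := lam.2
  exact mul_nonneg (by linarith) (Nat.cast_nonneg _)

lemma wait_mul_speed {x : V} (hx : 0 < (s.config x).numActive) :
    s.wait lam ω x * s.speed lam x = ringTime ω x (s.rings x) - s.clock x :=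
  div_mul_cancel₀ _ (speed_pos hx).ne'

lemma IsHistory.wait_nonneg (h : IsHistory lam ω Λ s l) (x : V) : 0 ≤ s.wait lam ω x :=
  div_nonneg (sub_nonneg.2 (h.clock_le x)) (speed_nonneg x)

/-- The vertex that rings minimises the waiting time, so no other clock overshoots its next ring. -/
lemma IsHistory.clock_add_le (h : IsHistory lam ω Λ s l) {x : V} (hx : s.IsNext lam ω x) (y : V) :
    s.clock y + s.wait lam ω x * s.speed lam y ≤ ringTime ω y (s.rings y) := by
  by_cases hy : 0 < (s.config y).numActive
  · have h1 := mul_le_mul_of_nonneg_right (hx.2 y hy) (speed_nonneg (s := s) (lam := lam) y)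
    rw [wait_mul_speed hy] at h1
    linarith
  · have : s.speed lam y = 0 := by
      simp [State.speed, Nat.eq_zero_of_not_pos hy]
    rw [this, mul_zero, add_zero]
    exact h.clock_le y

lemma ringTime_succ (y : V) (j : ℕ) :
    ringTime ω y (j + 1) = ringTime ω y j + ω.2.2 (y, j + 1) :=
  Finset.sum_range_succ _ _

/-- The clock of `x` lands exactly on its ring time. All the clocks together run at speed at most
`(1 + lam) * Λ.card`, since there are at most `Λ.card` active particles. -/
lemma IsHistory.ring (hω : ∀ p, 0 ≤ ω.2.2 p) (h : IsHistory lam ω Λ s l) {x : V}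
    (hx : s.IsNext lam ω x) : IsHistory lam ω Λ (s.ring lam ω x) (l ++ [x]) where
  legal := isLegal_append.2 ⟨h.legal, ⟨trivial, by rw [h.config_eq]; exact hx.1⟩, trivial⟩
  run_eq := by
    rw [run_append, h.run_eq]
    rfl
  le_clock y := by
    have hle := mul_nonneg (h.wait_nonneg x) (speed_nonneg (s := s) (lam := lam) y)
    by_cases hy : y = x
    · subst hy
      simp only [State.ring, Function.update_self]
      rw [wait_mul_speed hx.1, ringTime]
      linarith
    · simp only [State.ring, Function.update_of_ne hy]
      linarith [h.le_clock y]
  clock_le y := by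
    have h1 := h.clock_add_le hx y
    by_cases hy : y = x
    · subst hy
      simp only [State.ring, Function.update_self]
      rw [ringTime_succ]
      linarith [hω (y, s.rings y + 1)]
    · simp only [State.ring, Function.update_of_ne hy]
      exact h1
  sum_clock_le F := by
    have h1 := h.sum_clock_le F
    have h2 : (∑ y ∈ F, s.speed lam y) ≤ (1 + lam) * Λ.card := by
      simp only [State.speed]
      rw [← Finset.mul_sum]
      have h3 := h.legal.sum_numActive_le_card F
      rw [h.config_eq] at h3
      have h4 : ∑ y ∈ F, ((s.config y).numActive : ℝ) ≤ Λ.card := by exact_mod_cast h3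
      have : (0 : ℝ) ≤ lam := lam.2
      exact mul_le_mul_of_nonneg_left h4 (by linarith)
    have h3 := mul_le_mul_of_nonneg_left h2 (h.wait_nonneg x)
    simp only [State.ring, Finset.sum_add_distrib, ← Finset.mul_sum]
    nlinarith

lemma IsHistory.exists_isNext (h : IsHistory lam ω Λ s l) {x : V}
    (hx : 0 < (s.config x).numActive) : ∃ y, s.IsNext lam ω y := by
  have hfin := h.legal.finite_active
  rw [h.config_eq] at hfin
  obtain ⟨y, hy, hmin⟩ := Set.exists_min_image _ (s.wait lam ω) hfin ⟨x, hx⟩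
  exact ⟨y, hy, hmin⟩

lemma next_of_exists (h : ∃ x, s.IsNext lam ω x) :
    ∃ x, s.IsNext lam ω x ∧ s.next lam ω = s.ring lam ω x :=
  ⟨h.choose, h.choose_spec, dif_pos h⟩

lemma next_of_not_exists (h : ¬ ∃ x, s.IsNext lam ω x) :
    s.next lam ω = { s with time := s.time + 1 } := dif_neg h

lemma IsHistory.next (hω : ∀ p, 0 ≤ ω.2.2 p) (h : IsHistory lam ω Λ s l) :
    ∃ l', IsHistory lam ω Λ (s.next lam ω) l' := by
  by_cases hn : ∃ x, s.IsNext lam ω x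
  · obtain ⟨x, hx, he⟩ := next_of_exists hn
    exact ⟨_, he ▸ h.ring hω hx⟩
  · refine ⟨l, ?_⟩
    rw [next_of_not_exists hn]
    refine ⟨h.legal, h.run_eq, h.le_clock, h.clock_le, fun F => (h.sum_clock_le F).trans ?_⟩
    have : (0 : ℝ) ≤ lam := lam.2
    gcongr
    simp

lemma IsHistory.time_le_next (h : IsHistory lam ω Λ s l) : s.time ≤ (s.next lam ω).time := by
  by_cases hn : ∃ x, s.IsNext lam ω x
  · obtain ⟨x, hx, he⟩ := next_of_exists hn
    rw [he]
    exact le_add_of_nonneg_right (h.wait_nonneg x)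
  · rw [next_of_not_exists hn]
    simp

lemma rings_le_next (x : V) : s.rings x ≤ (s.next lam ω).rings x := by
  by_cases hn : ∃ x, s.IsNext lam ω x
  · obtain ⟨y, hy, he⟩ := next_of_exists hn
    rw [he]
    by_cases hxy : x = y
    · subst hxy; simp [State.ring]
    · simp [State.ring, hxy]
  · rw [next_of_not_exists hn]

/-- While `x` holds an active particle, its clock runs at speed at least `1 + λ`, until it
rings. -/
lemma IsHistory.clock_next (h : IsHistory lam ω Λ s l) {x : V}
    (hx : 0 < (s.config x).numActive) :
    s.clock x + (1 + lam) * ((s.next lam ω).time - s.time) ≤ (s.next lam ω).clock x ∧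
      (s.next lam ω).clock x ≤ ringTime ω x (s.rings x) ∧
      ((s.next lam ω).rings x = s.rings x → 0 < ((s.next lam ω).config x).numActive) := by
  obtain ⟨y, hy, he⟩ := next_of_exists (h.exists_isNext hx)
  rw [he]
  refine ⟨?_, h.clock_add_le hy x, fun hr => ?_⟩
  · have h1 : (1 : ℝ) ≤ (s.config x).numActive := by exact_mod_cast hx
    have h2 := h.wait_nonneg y
    have h3 : (0 : ℝ) ≤ lam := lam.2
    have h4 : (1 + lam : ℝ) ≤ s.speed lam x := le_mul_of_one_le_right (by linarith) h1
    have h5 := mul_le_mul_of_nonneg_left h4 h2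
    simp only [State.ring]
    linarith
  · have hxy : x ≠ y := by
      rintro rfl
      simp [State.ring] at hr
    simp only [State.ring]
    rw [applyInstruction_apply]
    exact hx.trans_le (numActive_le_localEffect hxy _ _)

lemma stateAfter_succ (n : ℕ) :
    stateAfter lam ω Λ (n + 1) = (stateAfter lam ω Λ n).next lam ω :=
  Function.iterate_succ_apply' _ _ _

lemma exists_isHistory (hω : ∀ p, 0 ≤ ω.2.2 p) (n : ℕ) :
    ∃ l, IsHistory lam ω Λ (stateAfter lam ω Λ n) l := by
  induction n with
  | zero => exact ⟨[], isHistory_initialState hω⟩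
  | succ n ih =>
    obtain ⟨l, hl⟩ := ih
    rw [stateAfter_succ]
    exact hl.next hω

lemma monotone_time (hω : ∀ p, 0 ≤ ω.2.2 p) :
    Monotone fun n => (stateAfter lam ω Λ n).time :=
  monotone_nat_of_le_succ fun n => by
    obtain ⟨l, hl⟩ := exists_isHistory (lam := lam) (Λ := Λ) hω n
    rw [stateAfter_succ]
    exact hl.time_le_next

lemma monotone_rings (x : V) : Monotone fun n => (stateAfter lam ω Λ n).rings x :=
  monotone_nat_of_le_succ fun n => by
    rw [stateAfter_succ]
    exact rings_le_next x

lemma time_of_stopped {m : ℕ} (hm : ¬ ∃ x, (stateAfter lam ω Λ m).IsNext lam ω x) (k : ℕ) :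
    stateAfter lam ω Λ (m + k) =
      { stateAfter lam ω Λ m with time := (stateAfter lam ω Λ m).time + k } := by
  induction k with
  | zero => simp
  | succ k ih =>
    rw [← add_assoc, stateAfter_succ, ih, next_of_not_exists]
    · simp [add_assoc]
    · exact hm

/-- No explosion. Either no active particle is left from some event on, and each further event lasts
one unit; or `n` events make `n` topplings, whose total waiting time is at most the sum of the
clocks, itself at most a constant times the elapsed time. -/
lemma tendsto_time (hω : ∀ p, 0 ≤ ω.2.2 p) (hd : WaitsDiverge ω) :
    Tendsto (fun n => (stateAfter lam ω Λ n).time) atTop atTop := by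
  refine tendsto_atTop_atTop_of_monotone (monotone_time hω) fun c => ?_
  by_cases hnext : ∃ m, ¬ ∃ x, (stateAfter lam ω Λ m).IsNext lam ω x
  · obtain ⟨m, hm⟩ := hnext
    obtain ⟨k, hk⟩ := exists_nat_ge (c - (stateAfter lam ω Λ m).time)
    refine ⟨m + k, ?_⟩
    rw [time_of_stopped hm]
    simp only
    linarith
  · push Not at hnext
    have hlen : ∀ n, ∃ l, IsHistory lam ω Λ (stateAfter lam ω Λ n) l ∧ l.length = n := by
      intro n
      induction n with
      | zero => exact ⟨[], isHistory_initialState hω, rfl⟩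
      | succ n ih =>
        obtain ⟨l, hl, hn⟩ := ih
        obtain ⟨x, hx, he⟩ := next_of_exists (hnext n)
        refine ⟨l ++ [x], ?_, by simp [hn]⟩
        rw [stateAfter_succ, he]
        exact hl.ring hω hx
    obtain ⟨n, hn⟩ := hd Λ ((1 + lam) * Λ.card * c)
    obtain ⟨l, hl, hln⟩ := hlen n
    refine ⟨n, ?_⟩
    by_contra! hlt
    have h1 := hn l hl.legal hln
    rw [totalWait_eq] at h1
    have h2 : ∑ y ∈ l.toFinset, ∑ i ∈ Finset.range (l.count y), ω.2.2 (y, i) ≤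
        ∑ y ∈ l.toFinset, (stateAfter lam ω Λ n).clock y := by
      refine Finset.sum_le_sum fun y _ => ?_
      rw [← hl.rings_eq]
      exact hl.le_clock y
    have h3 := hl.sum_clock_le l.toFinset
    have h4 : (0 : ℝ) ≤ (1 + lam) * Λ.card := by positivity
    have h5 := mul_le_mul_of_nonneg_left hlt.le h4
    linarith

/-- The number of events up to time `t`. -/
def eventCount (lam : ℝ≥0) (ω : Sample V) (Λ : Finset V) (t : ℝ) : ℕ :=
  sSup {n : ℕ | (stateAfter lam ω Λ n).time ≤ t}

/-- Without this bound the supremum in `finiteConfig` would take its default value 0. -/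
lemma bddAbove_events (hω : ∀ p, 0 ≤ ω.2.2 p) (hd : WaitsDiverge ω) (t : ℝ) :
    BddAbove {n : ℕ | (stateAfter lam ω Λ n).time ≤ t} := by
  obtain ⟨m, hm⟩ := ((tendsto_time (lam := lam) (Λ := Λ) hω hd).eventually_gt_atTop t).exists
  refine ⟨m, fun n hn => ?_⟩
  by_contra! hlt
  have : (stateAfter lam ω Λ m).time ≤ (stateAfter lam ω Λ n).time := monotone_time hω hlt.le
  exact absurd (this.trans hn) (not_le.2 hm)

lemma time_eventCount_le (hω : ∀ p, 0 ≤ ω.2.2 p) (hd : WaitsDiverge ω) {t : ℝ} (ht : 0 ≤ t) :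
    (stateAfter lam ω Λ (eventCount lam ω Λ t)).time ≤ t :=
  Nat.sSup_mem (s := {n : ℕ | (stateAfter lam ω Λ n).time ≤ t}) ⟨0, ht⟩ (bddAbove_events hω hd t)

lemma lt_time_eventCount_succ (hω : ∀ p, 0 ≤ ω.2.2 p) (hd : WaitsDiverge ω) (t : ℝ) :
    t < (stateAfter lam ω Λ (eventCount lam ω Λ t + 1)).time := by
  by_contra! hle
  have := le_csSup (bddAbove_events (lam := lam) (Λ := Λ) hω hd t) hle
  exact absurd this (Nat.not_succ_le_self _)

lemma eventCount_mono (hω : ∀ p, 0 ≤ ω.2.2 p) (hd : WaitsDiverge ω) {t t' : ℝ} (ht : 0 ≤ t)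
    (htt' : t ≤ t') : eventCount lam ω Λ t ≤ eventCount lam ω Λ t' :=
  le_csSup (bddAbove_events hω hd t') ((time_eventCount_le hω hd ht).trans htt')

/-- If `x` is active at times `t` and `t'` and does not ring in between, then `t' - t` is bounded
by the internal time of its clock. -/
lemma elapsed_le_ringTime (hω : ∀ p, 0 ≤ ω.2.2 p) (hd : WaitsDiverge ω) {t t' : ℝ} (ht : 0 ≤ t)
    (htt' : t ≤ t') {x : V} (hx : 0 < (finiteConfig lam ω Λ t x).numActive)
    (hr : (stateAfter lam ω Λ (eventCount lam ω Λ t')).rings x =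
      (stateAfter lam ω Λ (eventCount lam ω Λ t)).rings x) :
    (1 + lam) * (t' - t) ≤
      ringTime ω x ((stateAfter lam ω Λ (eventCount lam ω Λ t)).rings x) := by
  set n := eventCount lam ω Λ t with hn
  set n' := eventCount lam ω Λ t' with hn'
  have hnn' : n ≤ n' := eventCount_mono hω hd ht htt'
  have hrings : ∀ m, n ≤ m → m ≤ n' →
      (stateAfter lam ω Λ m).rings x = (stateAfter lam ω Λ n).rings x := fun m h1 h2 =>
    le_antisymm ((monotone_rings x h2).trans hr.le) (monotone_rings x h1)
  have key : ∀ k, n + k ≤ n' → 0 < ((stateAfter lam ω Λ (n + k)).config x).numActive ∧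
      (1 + lam) * ((stateAfter lam ω Λ (n + k)).time - (stateAfter lam ω Λ n).time) ≤
        (stateAfter lam ω Λ (n + k)).clock x := by
    intro k
    induction k with
    | zero =>
      intro _
      obtain ⟨l, hl⟩ := exists_isHistory (lam := lam) (Λ := Λ) hω n
      refine ⟨hx, ?_⟩
      rw [add_zero, sub_self, mul_zero]
      exact (Finset.sum_nonneg fun _ _ => hω _).trans (hl.le_clock x)
    | succ k ih =>
      intro hk
      obtain ⟨h1, h2⟩ := ih (by omega)
      obtain ⟨l, hl⟩ := exists_isHistory (lam := lam) (Λ := Λ) hω (n + k)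
      obtain ⟨h3, -, h5⟩ := hl.clock_next h1
      rw [← stateAfter_succ] at h3 h5
      refine ⟨h5 ((hrings (n + k + 1) (by omega) hk).trans
        (hrings (n + k) (by omega) (by omega)).symm), ?_⟩
      · rw [← add_assoc]
        linarith
  obtain ⟨h1, h2⟩ := key (n' - n) (by omega)
  rw [Nat.add_sub_cancel' hnn'] at h1 h2
  -- One event more: event `n' + 1` occurs after `t'`, and even then the clock of `x` has not passed
  -- its pending ring time.
  obtain ⟨l, hl⟩ := exists_isHistory (lam := lam) (Λ := Λ) hω n'
  obtain ⟨h3, h4, -⟩ := hl.clock_next h1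
  rw [← stateAfter_succ] at h3 h4
  rw [hr] at h4
  have h6 := time_eventCount_le (lam := lam) (Λ := Λ) hω hd ht
  have h7 := lt_time_eventCount_succ (lam := lam) (Λ := Λ) hω hd t'
  have h8 : (t' - t) ≤
      (stateAfter lam ω Λ (n' + 1)).time - (stateAfter lam ω Λ n).time := by linarith
  have h9 : (0 : ℝ) ≤ 1 + lam := by positivity
  have h10 := mul_le_mul_of_nonneg_left h8 h9
  linarith

lemma ringTime_mono (hω : ∀ p, 0 ≤ ω.2.2 p) (x : V) : Monotone (ringTime ω x) :=
  monotone_nat_of_le_succ fun j => by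
    rw [ringTime_succ]
    linarith [hω (x, j + 1)]

/-- The default value in `siteState` has no active particle, so activity in the limit means that the
finite systems do stabilise at an active state. -/
lemma eventually_active_of_siteState {t : ℝ} {x : V}
    (h : (siteState lam ω t x).numActive ≠ 0) :
    ∀ᶠ Λ : Finset V in atTop, 0 < (finiteConfig lam ω Λ t x).numActive := by
  unfold siteState at h
  split_ifs at h with hs
  · filter_upwards [hs.choose_spec] with Λ hΛ
    rw [hΛ]
    exact Nat.pos_of_ne_zero h
  · simp [SiteState.numActive] at h

/-- If each vertex is toppled a bounded number of times, then the process fixates. -/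
lemma fixates_of_not_unbounded (hω : ∀ p, 0 ≤ ω.2.2 p) (hd : WaitsDiverge ω)
    (hub : ∀ x, ¬ Unbounded ω.1 ω.2.1 x) : Fixates lam ω := by
  intro x
  have hx := hub x
  unfold Unbounded at hx
  push Not at hx
  obtain ⟨N, hN⟩ := hx
  have hring : ∀ (Λ : Finset V) n, (stateAfter lam ω Λ n).rings x < N := by
    intro Λ n
    obtain ⟨l, hl⟩ := exists_isHistory (lam := lam) (Λ := Λ) hω n
    rw [hl.rings_eq]
    exact hN Λ l hl.legal
  by_contra! hcon
  have hC : 0 ≤ ringTime ω x N := Finset.sum_nonneg fun _ _ => hω _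
  -- The times are fixed before `Λ`: for all large `Λ`, `x` is active at successive times with a
  -- ring in between. Taking `i = N` contradicts the bound `hring`, uniform in `Λ`.
  have key : ∀ i : ℕ, ∃ t : ℝ, 0 ≤ t ∧ ∀ᶠ Λ : Finset V in atTop,
      0 < (finiteConfig lam ω Λ t x).numActive ∧
        i ≤ (stateAfter lam ω Λ (eventCount lam ω Λ t)).rings x := by
    intro i
    induction i with
    | zero =>
      obtain ⟨t, ht, hact⟩ := hcon 0
      refine ⟨t, ht, ?_⟩
      filter_upwards [eventually_active_of_siteState hact] with Λ hΛ
      exact ⟨hΛ, Nat.zero_le _⟩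
    | succ i ih =>
      obtain ⟨t, ht, hev⟩ := ih
      -- A longer gap than an unrung clock allows, as fewer than `N` rings bound its internal time
      -- by `ringTime ω x N`.
      obtain ⟨t', ht', hact⟩ := hcon (t + ringTime ω x N + 1)
      refine ⟨t', by linarith, ?_⟩
      filter_upwards [hev, eventually_active_of_siteState hact] with Λ hΛ hΛ'
      refine ⟨hΛ', ?_⟩
      have hle : (stateAfter lam ω Λ (eventCount lam ω Λ t)).rings x ≤
          (stateAfter lam ω Λ (eventCount lam ω Λ t')).rings x :=
        monotone_rings x (eventCount_mono hω hd ht (by linarith))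
      rcases hle.lt_or_eq with hlt | heq
      · omega
      · exfalso
        have h1 := elapsed_le_ringTime hω hd ht (by linarith) hΛ.1 heq.symm
        have h2 := ringTime_mono hω x (hring Λ (eventCount lam ω Λ t)).le
        have h3 : (0 : ℝ) ≤ lam := lam.2
        have h4 : 0 ≤ t' - t := by linarith
        nlinarith
  obtain ⟨t, -, hev⟩ := key N
  obtain ⟨Λ, hΛ⟩ := hev.exists
  exact absurd (hring Λ (eventCount lam ω Λ t)) (not_lt.2 hΛ.2)

end Dynamics

/-! ### The waiting times -/

section Waits

lemma ae_expMeasure_pos : ∀ᵐ t ∂(expMeasure 1), (0 : ℝ) < t := by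
  have hprob : IsProbabilityMeasure (expMeasure 1) := isProbabilityMeasure_expMeasure one_pos
  have h := cdf_expMeasure_eq one_pos 0
  rw [cdf_eq_real] at h
  simp only [le_refl, if_true, mul_zero, neg_zero, Real.exp_zero, sub_self] at h
  rw [ae_iff]
  simp only [not_lt]
  exact (measureReal_eq_zero_iff (measure_ne_top _ _)).1 h

/-- The Laplace transform tends to 0 by dominated convergence, since waiting times are almost surely
positive. -/
lemma exists_lintegral_exp_lt {δ : ℝ≥0∞} (hδ : 0 < δ) :
    ∃ a : ℕ, ∫⁻ t, ENNReal.ofReal (Real.exp (-(a * t))) ∂(expMeasure 1) < δ := by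
  have hprob : IsProbabilityMeasure (expMeasure 1) := isProbabilityMeasure_expMeasure one_pos
  have h := tendsto_lintegral_of_dominated_convergence (μ := expMeasure 1)
    (F := fun (a : ℕ) (t : ℝ) => ENNReal.ofReal (Real.exp (-(a * t)))) (f := fun _ => 0)
    (fun _ => 1) (fun a => by fun_prop) ?_ (by simp) ?_
  · rw [lintegral_zero] at h
    exact (h.eventually_lt_const hδ).exists
  · intro a
    filter_upwards [ae_expMeasure_pos] with t ht
    rw [← ENNReal.ofReal_one]
    refine ENNReal.ofReal_le_ofReal (Real.exp_le_one_iff.2 ?_)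
    have : 0 ≤ (a : ℝ) * t := by positivity
    linarith
  · filter_upwards [ae_expMeasure_pos] with t ht
    rw [← ENNReal.ofReal_zero]
    refine ENNReal.tendsto_ofReal (Real.tendsto_exp_neg_atTop_nhds_zero.comp ?_)
    exact tendsto_natCast_atTop_atTop.atTop_mul_const ht

variable {V : Type*}

lemma card_usedIndices (l : List V) : (usedIndices l).card = l.length := by
  have h := totalWait_eq (fun _ => (1 : ℝ)) l
  simp only [totalWait, Finset.sum_const, Finset.card_range, nsmul_eq_mul, mul_one] at h
  rw [← List.sum_toFinset_count_eq_length]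
  exact_mod_cast h

lemma measurable_totalWait (l : List V) : Measurable fun w : V × ℕ → ℝ => totalWait w l := by
  unfold totalWait
  fun_prop

/-- The law of the waiting times. -/
def waitLaw (V : Type*) : Measure (V × ℕ → ℝ) := Measure.infinitePi fun _ => expMeasure 1

instance : IsProbabilityMeasure (waitLaw V) := by
  have : IsProbabilityMeasure (expMeasure 1) := isProbabilityMeasure_expMeasure one_pos
  unfold waitLaw
  infer_instance

/-- Markov's inequality for the exponential of minus `a` times the total waiting time; distinct
indices give independent factors. -/
lemma waitLaw_totalWait_le (a : ℕ) (c : ℝ) (l : List V) :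
    waitLaw V {w | totalWait w l ≤ c} ≤ ENNReal.ofReal (Real.exp (a * c)) *
      (∫⁻ t, ENNReal.ofReal (Real.exp (-(a * t))) ∂(expMeasure 1)) ^ l.length := by
  have hprob : IsProbabilityMeasure (expMeasure 1) := isProbabilityMeasure_expMeasure one_pos
  have hX : iIndepFun (fun (p : V × ℕ) (w : V × ℕ → ℝ) => ENNReal.ofReal (Real.exp (-(a * w p))))
      (waitLaw V) :=
    iIndepFun_infinitePi (X := fun _ t => ENNReal.ofReal (Real.exp (-(a * t))))
      fun _ => by fun_prop
  have h1 := lintegral_prod_eq_prod_lintegral_of_indepFun (usedIndices l) _ hX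
    fun p => by fun_prop
  have h2 : ∀ p : V × ℕ, ∫⁻ w, ENNReal.ofReal (Real.exp (-(a * w p))) ∂(waitLaw V) =
      ∫⁻ t, ENNReal.ofReal (Real.exp (-(a * t))) ∂(expMeasure 1) := by
    intro p
    rw [← Measure.infinitePi_map_eval (fun _ : V × ℕ => expMeasure 1) p,
      lintegral_map (by fun_prop) (by fun_prop)]
    rfl
  simp only [h2, Finset.prod_const, card_usedIndices] at h1
  rw [← h1]
  have h3 : ∀ w : V × ℕ → ℝ, ENNReal.ofReal (Real.exp (a * c)) *
      ∏ p ∈ usedIndices l, ENNReal.ofReal (Real.exp (-(a * w p))) =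
      ENNReal.ofReal (Real.exp (a * c - a * totalWait w l)) := by
    intro w
    rw [← ENNReal.ofReal_prod_of_nonneg fun _ _ => (Real.exp_pos _).le, ← Real.exp_sum,
      ← ENNReal.ofReal_mul (Real.exp_pos _).le, ← Real.exp_add, totalWait, Finset.mul_sum,
      Finset.sum_neg_distrib, sub_eq_add_neg]
  rw [← lintegral_const_mul _ (by fun_prop), ← one_mul (waitLaw V _)]
  simp only [h3]
  refine le_trans ?_ (mul_meas_ge_le_lintegral ?_ 1)
  · refine mul_le_mul_right (measure_mono fun w hw => ?_) _
    have hw' : totalWait w l ≤ c := hw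
    change 1 ≤ ENNReal.ofReal _
    rw [ENNReal.one_le_ofReal, Real.one_le_exp_iff]
    have := mul_le_mul_of_nonneg_left hw' (Nat.cast_nonneg (α := ℝ) a)
    linarith
  · have := measurable_totalWait l
    fun_prop

/-- There are at most `k ^ n` legal sequences of `n` topplings, where `k` bounds the number of
particles. -/
lemma exists_finset_isLegal (η : V → Bool) (τ : V × ℕ → Instruction V) (Λ : Finset V) (n : ℕ) :
    ∃ L : Finset (List V), (∀ l ∈ L, IsLegal (.on Set.univ) τ (initStage η Λ) l) ∧
      (∀ l, IsLegal (.on Set.univ) τ (initStage η Λ) l → l.length = n → l ∈ L) ∧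
      L.card ≤ Λ.card ^ n := by
  induction n with
  | zero =>
    refine ⟨{[]}, ?_, ?_, by simp⟩
    · intro l hl
      rw [Finset.mem_singleton.1 hl]
      trivial
    · intro l _ hl
      rw [Finset.mem_singleton]
      exact List.length_eq_zero_iff.1 hl
  | succ n ih =>
    obtain ⟨L, hL1, hL2, hL3⟩ := ih
    have hact : ∀ l : List V, ∃ A : Finset V, l ∈ L →
        ∀ v, v ∈ A ↔ 0 < ((run τ (initStage η Λ) l).1 v).numActive := by
      intro l
      by_cases hl : l ∈ L
      · exact ⟨(hL1 l hl).finite_active.toFinset, fun _ v => by simp⟩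
      · exact ⟨∅, fun h => absurd h hl⟩
    choose A hA using hact
    refine ⟨L.biUnion fun l => (A l).image fun v => l ++ [v], ?_, ?_, ?_⟩
    · intro l hl
      obtain ⟨l', hl', h⟩ := Finset.mem_biUnion.1 hl
      obtain ⟨v, hv, rfl⟩ := Finset.mem_image.1 h
      exact isLegal_append.2 ⟨hL1 l' hl', ⟨trivial, (hA l' hl' v).1 hv⟩, trivial⟩
    · intro l hl hlen
      rcases l.eq_nil_or_concat' with rfl | ⟨l', v, rfl⟩
      · simp at hlen
      · obtain ⟨h1, h2⟩ := isLegal_append.1 hl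
        have hl' : l' ∈ L := hL2 l' h1 (by simpa using hlen)
        exact Finset.mem_biUnion.2 ⟨l', hl', Finset.mem_image.2
          ⟨v, (hA l' hl' v).2 h2.1.2, rfl⟩⟩
    · rw [pow_succ]
      refine (Finset.card_biUnion_le_card_mul _ _ _ fun l hl => ?_).trans
        (Nat.mul_le_mul_right _ hL3)
      refine Finset.card_image_le.trans (le_trans ?_ ((hL1 l hl).sum_numActive_le_card (A l)))
      rw [Finset.card_eq_sum_ones]
      exact Finset.sum_le_sum fun v hv => (hA l hl v).1 hv

/-- For given particles and instructions, the total waiting time along legal sequences almost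
surely diverges. -/
lemma waitLaw_short_eq_zero (η : V → Bool) (τ : V × ℕ → Instruction V) (Λ : Finset V) (c : ℝ) :
    waitLaw V {w | ∀ n, ∃ l, IsLegal (.on Set.univ) τ (initStage η Λ) l ∧ l.length = n ∧
      totalWait w l ≤ c} = 0 := by
  -- Chosen so that `Λ.card * ρ < 1`: the decay `ρ ^ n` then beats the number `Λ.card ^ n` of legal
  -- sequences.
  obtain ⟨a, ha⟩ := exists_lintegral_exp_lt (δ := ((Λ.card : ℝ≥0∞) + 1)⁻¹)
    (ENNReal.inv_pos.2 (by finiteness))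
  set ρ := ∫⁻ t, ENNReal.ofReal (Real.exp (-(a * t))) ∂(expMeasure 1) with hρ
  have hr : Λ.card * ρ < 1 := by
    have h0 : ((Λ.card : ℝ≥0∞) + 1) ≠ 0 := by simp
    calc Λ.card * ρ ≤ (Λ.card + 1) * ρ := by gcongr; exact le_self_add
      _ < (Λ.card + 1) * ((Λ.card : ℝ≥0∞) + 1)⁻¹ :=
          (ENNReal.mul_lt_mul_iff_right h0 (by finiteness)).2 ha
      _ = 1 := ENNReal.mul_inv_cancel h0 (by finiteness)
  have hlim : Tendsto (fun n => ENNReal.ofReal (Real.exp (a * c)) * (Λ.card * ρ) ^ n) atTop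
      (nhds (ENNReal.ofReal (Real.exp (a * c)) * 0)) :=
    ENNReal.Tendsto.const_mul (ENNReal.tendsto_pow_atTop_nhds_zero_of_lt_one hr)
      (Or.inr ENNReal.ofReal_ne_top)
  rw [mul_zero] at hlim
  refine le_antisymm (ge_of_tendsto' hlim fun n => ?_) zero_le
  obtain ⟨L, -, hL2, hL3⟩ := exists_finset_isLegal η τ Λ n
  calc _ ≤ waitLaw V (⋃ l ∈ L.filter fun l => l.length = n, {w | totalWait w l ≤ c}) := by
        refine measure_mono fun w hw => ?_
        obtain ⟨l, h1, h2, h3⟩ := hw n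
        exact Set.mem_iUnion₂.2 ⟨l, Finset.mem_filter.2 ⟨hL2 l h1 h2, h2⟩, h3⟩
    _ ≤ ∑ l ∈ L.filter fun l => l.length = n, waitLaw V {w | totalWait w l ≤ c} :=
        measure_biUnion_finset_le _ _
    _ ≤ ∑ _l ∈ L.filter fun l => l.length = n, ENNReal.ofReal (Real.exp (a * c)) * ρ ^ n := by
        refine Finset.sum_le_sum fun l hl => ?_
        rw [← (Finset.mem_filter.1 hl).2]
        exact waitLaw_totalWait_le a c l
    _ ≤ (Λ.card : ℝ≥0∞) ^ n * (ENNReal.ofReal (Real.exp (a * c)) * ρ ^ n) := by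
        rw [Finset.sum_const, nsmul_eq_mul]
        gcongr
        exact_mod_cast (Finset.card_filter_le _ _).trans hL3
    _ = _ := by ring

end Waits

/-! ### The law of the random input -/

section SampleLaw

variable {V : Type*} {G : SimpleGraph V} [G.LocallyFinite] (lam : ℝ≥0) (μ : I)

lemma ae_sampleLaw_iff (hdeg : ∀ x, 0 < G.degree x) {p : Sample V → Prop} :
    (∀ᵐ ω ∂(sampleLaw G lam μ), p ω) ↔
      ∀ᵐ z ∂((stackLaw G lam μ).prod (waitLaw V)), p (z.1.1, z.1.2, z.2) := by
  have h1 : ∀ p : V × ℕ, IsProbabilityMeasure (instructionLaw G lam p.1) :=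
    fun p => isProbabilityMeasure_instructionLaw G lam p.1 (hdeg p.1)
  have hprob : IsProbabilityMeasure (expMeasure 1) := isProbabilityMeasure_expMeasure one_pos
  have h := Measure.prodAssoc_prod
    (μ := Measure.infinitePi fun _ : V => bernoulliMeasure true false μ)
    (ν := Measure.infinitePi fun p : V × ℕ => instructionLaw G lam p.1) (τ := waitLaw V)
  rw [sampleLaw, ← waitLaw, ← h, MeasurableEquiv.prodAssoc.measurableEmbedding.ae_map_iff]
  rfl

lemma ae_of_ae_stackLaw (hdeg : ∀ x, 0 < G.degree x)
    {p : (V → Bool) × (V × ℕ → Instruction V) → Prop} (h : ∀ᵐ z ∂(stackLaw G lam μ), p z) :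
    ∀ᵐ ω ∂(sampleLaw G lam μ), p (ω.1, ω.2.1) := by
  have hprob := isProbabilityMeasure_stackLaw G lam μ hdeg
  rw [ae_sampleLaw_iff lam μ hdeg]
  exact Measure.quasiMeasurePreserving_fst.ae h

lemma ae_wait_nonneg [Countable V] (hdeg : ∀ x, 0 < G.degree x) :
    ∀ᵐ ω ∂(sampleLaw G lam μ), ∀ p, 0 ≤ ω.2.2 p := by
  have hprob := isProbabilityMeasure_stackLaw G lam μ hdeg
  have hprob' : IsProbabilityMeasure (expMeasure 1) := isProbabilityMeasure_expMeasure one_pos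
  rw [ae_sampleLaw_iff lam μ hdeg]
  have : ∀ᵐ w ∂(waitLaw V), ∀ p, 0 ≤ w p := by
    rw [ae_all_iff]
    intro p
    filter_upwards [(measurePreserving_eval_infinitePi
      (fun _ : V × ℕ => expMeasure 1) p).quasiMeasurePreserving.ae ae_expMeasure_pos] with w hw
    exact hw.le
  exact Measure.quasiMeasurePreserving_snd.ae this

/-- By Fubini it suffices to fix particles and instructions; the legal sequences are then
deterministic and only the waiting times are random. -/
lemma ae_waitsDiverge [Countable V] (hdeg : ∀ x, 0 < G.degree x) :
    ∀ᵐ ω ∂(sampleLaw G lam μ), WaitsDiverge ω := by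
  have hprob := isProbabilityMeasure_stackLaw G lam μ hdeg
  rw [ae_sampleLaw_iff lam μ hdeg]
  -- Natural thresholds suffice and leave only countably many events to combine.
  have key : ∀ (Λ : Finset V) (c : ℕ), ∀ᵐ z ∂((stackLaw G lam μ).prod (waitLaw V)),
      ¬ ∀ n, ∃ l, IsLegal (.on Set.univ) z.1.2 (initStage z.1.1 Λ) l ∧ l.length = n ∧
        totalWait z.2 l ≤ c := by
    intro Λ c
    have hm : MeasurableSet {z : ((V → Bool) × (V × ℕ → Instruction V)) × (V × ℕ → ℝ) |
        ∀ n, ∃ l, IsLegal (.on Set.univ) z.1.2 (initStage z.1.1 Λ) l ∧ l.length = n ∧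
          totalWait z.2 l ≤ c} := by
      refine measurableSet_setOfPred.2 (Measurable.forall fun n => Measurable.exists fun l => ?_)
      refine Measurable.and ?_ (Measurable.and measurable_const ?_)
      · exact measurableSet_setOfPred.1 (measurable_fst (measurableSet_isLegal _ Λ l))
      · exact measurableSet_setOfPred.1
          (measurableSet_le ((measurable_totalWait l).comp measurable_snd) measurable_const)
    rw [ae_iff]
    simp only [not_not]
    rw [Measure.measure_prod_null hm]
    exact ae_of_all _ fun z => waitLaw_short_eq_zero z.1 z.2 Λ c
  have key' := (ae_all_iff (ι := Finset V × ℕ)).2 fun q => key q.1 q.2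
  filter_upwards [key'] with z hz Λ c
  obtain ⟨k, hk⟩ := exists_nat_ge c
  have := hz (Λ, k)
  push Not at this
  obtain ⟨n, hn⟩ := this
  exact ⟨n, fun l hl hlen => hk.trans_lt (hn l hl hlen)⟩

/-- A vertex with unbounded topplings would make every vertex unbounded, hence visited, which almost
surely does not happen below q. -/
lemma probActive_eq_zero [Infinite V] (hconn : G.Connected) (htrans : VertexTransitive G)
    (hamen : Amenable G) (hμ : (μ : ℝ) < (lam : ℝ) / (1 + lam)) : probActive G lam μ = 0 := by
  have hcount := countable_of_connected hconn
  have hdeg : ∀ x, 0 < G.degree x := fun x => hconn.preconnected.degree_pos_of_nontrivial x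
  have h1 : ∀ᵐ p ∂(stackLaw G lam μ), p ∉ allVisited V :=
    measure_eq_zero_iff_ae_notMem.1
      (measure_allVisited_eq_zero lam μ hconn hdeg htrans hamen hμ)
  have hfix : ∀ᵐ ω ∂(sampleLaw G lam μ), Fixates lam ω := by
    filter_upwards [ae_of_ae_stackLaw lam μ hdeg h1,
      ae_of_ae_stackLaw lam μ hdeg (ae_recurrent_stackLaw lam μ hdeg),
      ae_wait_nonneg lam μ hdeg, ae_waitsDiverge lam μ hdeg] with ω hvis hrec hω hd
    exact fixates_of_not_unbounded hω hd fun x hx =>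
      hvis fun y => (hx.all hconn hrec y).exists_visited
  exact ae_iff.1 hfix

end SampleLaw

end ARW

end

theorem theorem3 {V : Type*} [Infinite V] (G : SimpleGraph V) [G.LocallyFinite]
    (hconn : G.Connected) (htrans : ARW.VertexTransitive G) (hamen : ARW.Amenable G)
    (lam : ℝ≥0) (hlam : 0 < lam) :
    (0 : ℝ) < ARW.criticalDensity G lam ∧
      (lam : ℝ) / (1 + lam) ≤ ARW.criticalDensity G lam := by
  have hpos : (0 : ℝ) < (lam : ℝ) / (1 + lam) := by positivity
  have hle : (lam : ℝ) / (1 + lam) ≤ 1 := by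
    rw [div_le_one (by positivity)]
    linarith
  have h : (⟨(lam : ℝ) / (1 + lam), hpos.le, hle⟩ : I) ≤ ARW.criticalDensity G lam := by
    refine le_sInf fun μ hμ => ?_
    by_contra hlt
    exact hμ.ne' (ARW.probActive_eq_zero lam μ hconn htrans hamen (not_le.1 hlt))
  exact ⟨hpos.trans_le h, h⟩
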